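/- Let $P_1(\mathbb R)$ be the real projective line with projective coordinate $x=x_1/x_2$, let $\lambda$ be the $SO(2)\times SO(2)$-invariant measure on $P_1(\mathbb R)\times P_1(\mathbb R)$ (unique up to a positive factor), and let $\mathcal G=SL(2,\mathbb R)\times SL(2,\mathbb R)$ act on the real Hilbert space $L^2=L^2(P_1(\mathbb R)\times P_1(\mathbb R),\lambda,\mathbb R)$ by $$(T(g,h)\alpha)(x,y)=k_g(x)s_g(x)\,k_h(y)s_h(y)\,\alpha(xg,yh),$$ where for $g=\begin{pmatrix}a&b\\c&d\end{pmatrix}$ $$xg=\frac{xa+c}{xb+d},\qquad k_g(x)=\Big(\frac{(xb+d)^2+(xa+c)^2}{1+x^2}\Big)^{1/2},\qquad s_g(x)=\frac{xb+d}{|xb+d|}.$$ Let $T'$ be the dual action of $\mathcal G$ on the topological dual $(L^2)'\simeq L^2$, $\langle T'(g,h)\phi,\alpha\rangle=\langle\phi,T(g^{-1},h^{-1})\alpha\rangle$. The little group of $\phi\in(L^2)'$ is its stabilizer $L_\phi=\{(g,h)\in\mathcal G: T'(g,h)\phi=\phi\}$. An infinite closed subgroup $S$ of $SO(2)\times SO(2)$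 is called an infinite potential little group if some nonzero $\phi\in(L^2)'$ is fixed by all of $S$; a subgroup $S$ of $\mathcal G$ is called an actual little group if $S=L_\phi$ for some $\phi\in(L^2)'$. Put $R(\theta)=\begin{pmatrix}\cos\theta&\sin\theta\\-\sin\theta&\cos\theta\end{pmatrix}$ and, for a positive integer $N$ and integers $q,p$, $$H(N,q,p)=\{(R(q\theta),R(p\theta+\tfrac{2\pi}{N}i)):\theta\in\mathbb R,\ i\in\{0,1,\dots,N-1\}\}=C_N\cdot S^1_{(q,p)},$$ where $C_N=\{(I,R(\tfrac{2\pi}{N}i))\}$ and $S^1_{(q,p)}=\{(R(q\theta),R(p\theta))\}$. **Theorem.** All the infinite potential little groups are actual: every infinite potential little group is the exact stabilizer $L_\phi$ in $\mathcal G$ of some $\phi\in(L^2)'$. The infinite potential little groups are exactly the groups $H(N,q,p)$ with $N$ odd and $q,p$ odd and relatively prime. Each of these groups is one-dimensional; as a topological group, $H(N,q,p)\cong C_{N/\gcd(N,q)}\times S^1$. -/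

import Mathlib

open MeasureTheory Matrix
open scoped ENNReal MatrixGroups

noncomputable section

namespace HB

/-- The group `SL(2,ℝ) × SL(2,ℝ)`. -/
abbrev GG : Type := SL(2, ℝ) × SL(2, ℝ)

/-- The real projective line `P₁(ℝ)`: lines in the plane of row vectors `(x₁, x₂)`. -/
abbrev P1 : Type := Projectivization ℝ (Fin 2 → ℝ)

/-- The quotient (= Borel) σ-algebra on `P₁(ℝ)`. -/
instance instMeasurableSpaceP1 : MeasurableSpace P1 :=
  inferInstanceAs (MeasurableSpace (Quotient (projectivizationSetoid ℝ (Fin 2 → ℝ))))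

lemma vecMul_injective (g : SL(2, ℝ)) :
    Function.Injective (Matrix.vecMulLinear (g : Matrix (Fin 2) (Fin 2) ℝ)) := by
  intro v w h
  have h' : v ᵥ* (g : Matrix (Fin 2) (Fin 2) ℝ) = w ᵥ* (g : Matrix (Fin 2) (Fin 2) ℝ) := h
  have := congrArg (fun u => u ᵥ* ((g⁻¹ : SL(2, ℝ)) : Matrix (Fin 2) (Fin 2) ℝ)) h'
  simp only [Matrix.vecMul_vecMul, ← Matrix.SpecialLinearGroup.coe_mul, mul_inv_cancel,
    Matrix.SpecialLinearGroup.coe_one, Matrix.vecMul_one] at this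
  exact this

/-- The right action `x ↦ xg` of `SL(2,ℝ)` on `P₁(ℝ)`, induced by `v ↦ v g` on row vectors. -/
def act (g : SL(2, ℝ)) : P1 → P1 :=
  Projectivization.map (Matrix.vecMulLinear (g : Matrix (Fin 2) (Fin 2) ℝ)) (vecMul_injective g)

/-- The projective coordinate `x = x₁ / x₂` (with the value `0` at the point at infinity, which is
a null set). -/
def coord : P1 → ℝ :=
  Projectivization.lift (fun v => v.1 0 / v.1 1) (by
    intro a b t h
    have ht : t ≠ 0 := by
      rintro rfl
      exact a.2 (by simpa using h)
    simp only [h, Pi.smul_apply, smul_eq_mul]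
    exact mul_div_mul_left _ _ ht)

/-- `k_g(x) = (((xb + d)² + (xa + c)²) / (1 + x²))^(1/2)` for `g = [[a, b], [c, d]]`. -/
def kFactor (g : SL(2, ℝ)) (x : ℝ) : ℝ :=
  Real.sqrt (((x * g 0 1 + g 1 1) ^ 2 + (x * g 0 0 + g 1 0) ^ 2) / (1 + x ^ 2))

/-- `s_g(x) = (xb + d) / |xb + d|` for `g = [[a, b], [c, d]]`. -/
def sFactor (g : SL(2, ℝ)) (x : ℝ) : ℝ :=
  (x * g 0 1 + g 1 1) / |x * g 0 1 + g 1 1|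

lemma angle_ne_zero (α : ℝ) : (![Real.cos α, Real.sin α] : Fin 2 → ℝ) ≠ 0 := by
  intro h
  have h0 : Real.cos α = 0 := by simpa using congrFun h 0
  have h1 : Real.sin α = 0 := by simpa using congrFun h 1
  have := Real.sin_sq_add_cos_sq α
  simp [h0, h1] at this

/-- The point of `P₁(ℝ)` at angle `α`, i.e. with projective coordinate `cot α`. -/
def ofAngle (α : ℝ) : P1 := Projectivization.mk ℝ ![Real.cos α, Real.sin α] (angle_ne_zero α)

/-- The rotation-invariant measure `dα` on `P₁(ℝ)`, where `0 < α ≤ π` (in the projective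
coordinate it is `dx / (1 + x²)`). -/
def lam1 : Measure P1 := Measure.map ofAngle (volume.restrict (Set.Ioc 0 Real.pi))

/-- The measure `λ` on the torus `P₁(ℝ) × P₁(ℝ)`, invariant under `SO(2) × SO(2)`. -/
def lam : Measure (P1 × P1) := lam1.prod lam1

/-- The real Hilbert space `L²(P₁(ℝ) × P₁(ℝ), λ, ℝ)`. -/
abbrev L2 : Type := Lp ℝ 2 lam

/-! ### Measurability and quasi-invariance, needed to define the representation `T` -/

lemma measurable_of_comp_mk {β : Type*} [MeasurableSpace β] {f : P1 → β}
    (h : Measurable fun v : {v : Fin 2 → ℝ // v ≠ 0} => f (Projectivization.mk ℝ v.1 v.2)) :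
    Measurable f :=
  measurable_from_quotient.2 h

lemma measurable_mk :
    Measurable fun v : {v : Fin 2 → ℝ // v ≠ 0} => (Projectivization.mk ℝ v.1 v.2 : P1) :=
  measurable_quotient_mk''

lemma measurable_mk_comp {β : Type*} [MeasurableSpace β] {f : β → Fin 2 → ℝ} (hf : Measurable f)
    (h0 : ∀ b, f b ≠ 0) : Measurable fun b => (Projectivization.mk ℝ (f b) (h0 b) : P1) :=
  measurable_mk.comp (hf.subtype_mk (h := h0))

lemma measurable_ofAngle : Measurable ofAngle := by
  refine measurable_mk_comp ?_ angle_ne_zero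
  refine measurable_pi_iff.2 fun i => ?_
  fin_cases i
  · exact Real.measurable_cos
  · exact Real.measurable_sin

lemma measurable_act (g : SL(2, ℝ)) : Measurable (act g) := by
  refine measurable_of_comp_mk ?_
  refine measurable_mk_comp (f := fun v : {v : Fin 2 → ℝ // v ≠ 0} =>
    Matrix.vecMulLinear (g : Matrix (Fin 2) (Fin 2) ℝ) v.1) ?_ ?_
  exact (LinearMap.continuous_of_finiteDimensional _).measurable.comp measurable_subtype_coe

lemma measurable_coord : Measurable coord := by
  refine measurable_of_comp_mk ?_
  have h0 : Measurable fun v : {v : Fin 2 → ℝ // v ≠ 0} => v.1 0 :=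
    (measurable_pi_apply 0).comp measurable_subtype_coe
  have h1 : Measurable fun v : {v : Fin 2 → ℝ // v ≠ 0} => v.1 1 :=
    (measurable_pi_apply 1).comp measurable_subtype_coe
  exact h0.div h1

instance : IsFiniteMeasure lam1 := by unfold lam1; infer_instance

instance : IsFiniteMeasure lam := by unfold lam; infer_instance

lemma affine_ne_zero (x : ℝ) : (![x, 1] : Fin 2 → ℝ) ≠ 0 := by
  intro h
  simpa using congrFun h 1

/-- The point with projective coordinate `x`. -/
def ofCoord (x : ℝ) : P1 := Projectivization.mk ℝ ![x, 1] (affine_ne_zero x)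

lemma measurable_ofCoord : Measurable ofCoord := by
  refine measurable_mk_comp ?_ affine_ne_zero
  refine measurable_pi_iff.2 fun i => ?_
  fin_cases i
  · exact measurable_id
  · exact measurable_const

lemma ofAngle_arctan (x : ℝ) : ofAngle (Real.pi / 2 - Real.arctan x) = ofCoord x := by
  refine (Projectivization.mk_eq_mk_iff' ℝ _ _ _ _).2 ⟨Real.cos (Real.arctan x), ?_⟩
  have h : Real.cos (Real.arctan x) ≠ 0 := (Real.cos_arctan_pos x).ne'
  have h2 : Real.cos (Real.arctan x) * x = Real.sin (Real.arctan x) := by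
    conv_lhs => rw [← Real.tan_arctan x, Real.arctan_tan (Real.neg_pi_div_two_lt_arctan x)
      (Real.arctan_lt_pi_div_two x)]
    rw [Real.tan_eq_sin_div_cos]
    field_simp
  ext i
  fin_cases i
  · simpa [Real.cos_pi_div_two_sub] using h2
  · simp [Real.sin_pi_div_two_sub]

lemma lintegral_lam1 {f : P1 → ℝ≥0∞} (hf : Measurable f) :
    ∫⁻ P, f P ∂lam1 = ∫⁻ x : ℝ, ENNReal.ofReal (1 / (1 + x ^ 2)) * f (ofCoord x) := by
  have him : (fun x : ℝ => Real.pi / 2 - Real.arctan x) '' Set.univ = Set.Ioo 0 Real.pi := by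
    ext y
    constructor
    · rintro ⟨x, -, rfl⟩
      have h1 := Real.neg_pi_div_two_lt_arctan x
      have h2 := Real.arctan_lt_pi_div_two x
      constructor <;> dsimp only <;> linarith
    · rintro ⟨h1, h2⟩
      refine ⟨Real.tan (Real.pi / 2 - y), trivial, ?_⟩
      dsimp only
      rw [Real.arctan_tan (by linarith) (by linarith)]
      ring
  have key := lintegral_image_eq_lintegral_abs_deriv_mul (s := Set.univ)
    (f := fun x : ℝ => Real.pi / 2 - Real.arctan x) (f' := fun x => -(1 / (1 + x ^ 2)))
    MeasurableSet.univ
    (fun x _ => ((Real.hasDerivAt_arctan x).const_sub (Real.pi / 2)).hasDerivWithinAt)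
    (fun x _ y _ h => Real.arctan_injective (by dsimp only at h; linarith))
    (fun α => f (ofAngle α))
  rw [lam1, lintegral_map hf measurable_ofAngle, ← restrict_Ioo_eq_restrict_Ioc, ← him, key,
    Measure.restrict_univ]
  refine lintegral_congr fun x => ?_
  rw [ofAngle_arctan, abs_neg, abs_of_nonneg (by positivity)]

/-- The sum of the squares of the entries of `g`. -/
def frob (g : SL(2, ℝ)) : ℝ := g 0 0 ^ 2 + g 0 1 ^ 2 + g 1 0 ^ 2 + g 1 1 ^ 2

lemma frob_nonneg (g : SL(2, ℝ)) : 0 ≤ frob g := by unfold frob; positivity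

lemma kSq_le (g : SL(2, ℝ)) (x : ℝ) :
    (x * g 0 1 + g 1 1) ^ 2 + (x * g 0 0 + g 1 0) ^ 2 ≤ frob g * (1 + x ^ 2) := by
  unfold frob
  nlinarith [sq_nonneg (x * g 1 1 - g 0 1), sq_nonneg (x * g 1 0 - g 0 0)]

lemma act_ofCoord (g : SL(2, ℝ)) (x : ℝ) (hx : x * g 0 1 + g 1 1 ≠ 0) :
    act g (ofCoord x) = ofCoord ((x * g 0 0 + g 1 0) / (x * g 0 1 + g 1 1)) := by
  unfold act ofCoord
  rw [Projectivization.map_mk]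
  refine (Projectivization.mk_eq_mk_iff' ℝ _ _ _ _).2 ⟨x * g 0 1 + g 1 1, ?_⟩
  ext i
  fin_cases i
  · simp [Matrix.vecMul, dotProduct, Fin.sum_univ_two]
    field_simp
  · simp [Matrix.vecMul, dotProduct, Fin.sum_univ_two]

lemma det_eq (g : SL(2, ℝ)) : g 0 0 * g 1 1 - g 0 1 * g 1 0 = 1 := by
  have := g.det_coe
  rwa [Matrix.det_fin_two] at this

lemma pole_null (g : SL(2, ℝ)) : volume {x : ℝ | x * g 0 1 + g 1 1 = 0} = 0 := by
  refine Set.Subsingleton.measure_zero ?_ _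
  intro x hx y hy
  simp only [Set.mem_ofPred_eq] at hx hy
  have hd := det_eq g
  have hb : g 0 1 ≠ 0 := by
    intro hb
    have h1 : g 1 1 = 0 := by simpa [hb] using hx
    simp [hb, h1] at hd
  have : (x - y) * g 0 1 = 0 := by linarith
  rcases mul_eq_zero.1 this with h | h
  · linarith
  · exact absurd h hb

lemma lintegral_act_le (g : SL(2, ℝ)) {f : P1 → ℝ≥0∞} (hf : Measurable f) :
    ∫⁻ P, f (act g P) ∂lam1 ≤ ENNReal.ofReal (frob g) * ∫⁻ P, f P ∂lam1 := by
  set s : Set ℝ := {x : ℝ | x * g 0 1 + g 1 1 ≠ 0} with hs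
  have hms : MeasurableSet s := by
    have : Measurable fun x : ℝ => x * g 0 1 + g 1 1 := by fun_prop
    exact (this (measurableSet_singleton 0)).compl
  have hae : s =ᵐ[volume] Set.univ := by
    rw [ae_eq_univ]
    convert pole_null g using 2
    ext x; simp [hs]
  set m : ℝ → ℝ := fun x => (x * g 0 0 + g 1 0) / (x * g 0 1 + g 1 1) with hm
  have hd := det_eq g
  have hderiv : ∀ x ∈ s, HasDerivWithinAt m (1 / (x * g 0 1 + g 1 1) ^ 2) s x := by
    intro x hx
    have h1 : HasDerivAt (fun x : ℝ => x * g 0 0 + g 1 0) (g 0 0) x := by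
      simpa using ((hasDerivAt_id x).mul_const (g 0 0)).add_const (g 1 0)
    have h2 : HasDerivAt (fun x : ℝ => x * g 0 1 + g 1 1) (g 0 1) x := by
      simpa using ((hasDerivAt_id x).mul_const (g 0 1)).add_const (g 1 1)
    have h3 := h1.div h2 hx
    refine (h3.congr_deriv ?_).hasDerivWithinAt
    congr 1
    linear_combination hd
  have hinj : Set.InjOn m s := by
    intro x hx y hy h
    simp only [hm] at h
    rw [div_eq_div_iff hx hy] at h
    linear_combination h + (y - x) * hd
  have key := lintegral_image_eq_lintegral_abs_deriv_mul hms hderiv hinj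
    (fun y => ENNReal.ofReal (1 / (1 + y ^ 2)) * f (ofCoord y))
  have hact := lintegral_lam1 (f := fun P => f (act g P)) (hf.comp (measurable_act g))
  rw [hact, lintegral_lam1 hf, ← setLIntegral_univ, ← setLIntegral_congr hae]
  calc ∫⁻ x in s, ENNReal.ofReal (1 / (1 + x ^ 2)) * f (act g (ofCoord x))
      ≤ ∫⁻ x in s, ENNReal.ofReal (frob g) * (ENNReal.ofReal |1 / (x * g 0 1 + g 1 1) ^ 2| *
          (ENNReal.ofReal (1 / (1 + m x ^ 2)) * f (ofCoord (m x)))) := by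
        refine setLIntegral_mono' hms fun x hx => ?_
        rw [act_ofCoord g x hx, ← mul_assoc, ← mul_assoc, ← ENNReal.ofReal_mul (frob_nonneg g),
          ← ENNReal.ofReal_mul (mul_nonneg (frob_nonneg g) (abs_nonneg _))]
        gcongr
        rw [abs_of_nonneg (by positivity)]
        have hx' : x * g 0 1 + g 1 1 ≠ 0 := hx
        have hk := kSq_le g x
        have hpos : 0 < (x * g 0 1 + g 1 1) ^ 2 + (x * g 0 0 + g 1 0) ^ 2 := by positivity
        have e : frob g * (1 / (x * g 0 1 + g 1 1) ^ 2) * (1 / (1 + m x ^ 2)) =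
            frob g / ((x * g 0 1 + g 1 1) ^ 2 + (x * g 0 0 + g 1 0) ^ 2) := by
          simp only [hm]
          field_simp
        rw [e, div_le_div_iff₀ (by positivity) hpos]
        linarith
    _ = ENNReal.ofReal (frob g) * ∫⁻ y in m '' s,
          ENNReal.ofReal (1 / (1 + y ^ 2)) * f (ofCoord y) := by
        rw [lintegral_const_mul' _ _ ENNReal.ofReal_ne_top, key]
    _ ≤ _ := by
        gcongr
        exact Measure.restrict_le_self

lemma map_act_le (g : SL(2, ℝ)) :
    Measure.map (act g) lam1 ≤ ENNReal.ofReal (frob g) • lam1 := by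
  refine Measure.le_iff.2 fun s hs => ?_
  have h := lintegral_act_le g (f := s.indicator 1) (measurable_one.indicator hs)
  rw [← lintegral_map (measurable_one.indicator hs) (measurable_act g),
    lintegral_indicator_one hs, lintegral_indicator_one hs] at h
  simpa using h

/-- The right action of `SL(2,ℝ) × SL(2,ℝ)` on the torus `P₁(ℝ) × P₁(ℝ)`. -/
def actTorus (z : GG) : P1 × P1 → P1 × P1 := Prod.map (act z.1) (act z.2)

lemma measurable_actTorus (z : GG) : Measurable (actTorus z) :=
  (measurable_act z.1).prodMap (measurable_act z.2)

/-- A constant with `λ ∘ z⁻¹ ≤ (boundConst z) λ`. -/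
def boundConst (z : GG) : ℝ≥0∞ := ENNReal.ofReal (frob z.1) * ENNReal.ofReal (frob z.2)

lemma boundConst_ne_top (z : GG) : boundConst z ≠ ⊤ :=
  ENNReal.mul_ne_top ENNReal.ofReal_ne_top ENNReal.ofReal_ne_top

lemma map_actTorus_le (z : GG) : Measure.map (actTorus z) lam ≤ boundConst z • lam := by
  unfold lam actTorus boundConst
  rw [← Measure.map_prod_map _ _ (measurable_act z.1) (measurable_act z.2)]
  have : SFinite (ENNReal.ofReal (frob z.2) • lam1) := inferInstance
  refine (Measure.prod_mono (map_act_le z.1) (map_act_le z.2)).trans (le_of_eq ?_)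
  rw [Measure.prod_smul_left, Measure.prod_smul_right, smul_smul]

lemma quasiMeasurePreserving_actTorus (z : GG) :
    Measure.QuasiMeasurePreserving (actTorus z) lam lam :=
  ⟨measurable_actTorus z, (Measure.absolutelyContinuous_of_le (map_actTorus_le z)).trans
    (Measure.smul_absolutelyContinuous)⟩

/-- The multiplier `k_g(x) s_g(x) k_h(y) s_h(y)`. -/
def multiplier (z : GG) (w : P1 × P1) : ℝ :=
  kFactor z.1 (coord w.1) * sFactor z.1 (coord w.1) *
    (kFactor z.2 (coord w.2) * sFactor z.2 (coord w.2))

lemma measurable_multiplier (z : GG) : Measurable (multiplier z) := by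
  have hk : ∀ g : SL(2, ℝ), Measurable (kFactor g) := fun g => by
    unfold kFactor; fun_prop
  have hs : ∀ g : SL(2, ℝ), Measurable (sFactor g) := fun g => by
    unfold sFactor
    have : Measurable fun x : ℝ => x * g 0 1 + g 1 1 := by fun_prop
    exact this.div (_root_.continuous_abs.measurable.comp this)
  have h1 : Measurable fun w : P1 × P1 => coord w.1 := measurable_coord.comp measurable_fst
  have h2 : Measurable fun w : P1 × P1 => coord w.2 := measurable_coord.comp measurable_snd
  exact (((hk _).comp h1).mul ((hs _).comp h1)).mul (((hk _).comp h2).mul ((hs _).comp h2))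

lemma abs_factor_le (g : SL(2, ℝ)) (x : ℝ) :
    |kFactor g x * sFactor g x| ≤ Real.sqrt (frob g) := by
  rw [abs_mul]
  have h1 : |kFactor g x| ≤ Real.sqrt (frob g) := by
    unfold kFactor
    rw [abs_of_nonneg (Real.sqrt_nonneg _)]
    refine Real.sqrt_le_sqrt ?_
    rw [div_le_iff₀ (by positivity)]
    exact kSq_le g x
  have h2 : |sFactor g x| ≤ 1 := by
    unfold sFactor
    rw [abs_div, abs_abs]
    exact div_self_le_one _
  calc _ ≤ Real.sqrt (frob g) * 1 := by gcongr
    _ = _ := mul_one _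

/-- A bound for the multiplier. -/
def multBound (z : GG) : ℝ := Real.sqrt (frob z.1) * Real.sqrt (frob z.2)

lemma norm_multiplier_le (z : GG) (w : P1 × P1) : ‖multiplier z w‖ ≤ multBound z := by
  rw [Real.norm_eq_abs, multiplier, abs_mul]
  unfold multBound
  gcongr <;> exact abs_factor_le _ _

lemma eLpNorm_T_le (z : GG) (α : L2) :
    eLpNorm (fun w => multiplier z w * α (actTorus z w)) 2 lam ≤
      ENNReal.ofReal (multBound z) * (boundConst z ^ (1 / 2 : ℝ) * eLpNorm α 2 lam) := by
  have h1 : eLpNorm (fun w => multiplier z w * α (actTorus z w)) 2 lam ≤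
      ENNReal.ofReal (multBound z) * eLpNorm (fun w => α (actTorus z w)) 2 lam := by
    refine eLpNorm_le_mul_eLpNorm_of_ae_le_mul (Filter.Eventually.of_forall fun w => ?_) 2
    rw [norm_mul]
    gcongr
    exact norm_multiplier_le z w
  have h2 : eLpNorm (fun w => α (actTorus z w)) 2 lam = eLpNorm α 2 (Measure.map (actTorus z) lam) :=
    (eLpNorm_map_measure ((Lp.aestronglyMeasurable α).mono_ac
      (quasiMeasurePreserving_actTorus z).absolutelyContinuous)
      (measurable_actTorus z).aemeasurable).symm
  refine h1.trans ?_
  rw [h2]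
  gcongr
  refine (eLpNorm_mono_measure _ (map_actTorus_le z)).trans ?_
  refine (eLpNorm_smul_measure_of_ne_top (by simp) _ _).le.trans ?_
  simp

lemma memLp_T (z : GG) (α : L2) :
    MemLp (fun w => multiplier z w * α (actTorus z w)) 2 lam := by
  refine ⟨(measurable_multiplier z).aestronglyMeasurable.mul
    ((Lp.aestronglyMeasurable α).comp_quasiMeasurePreserving
      (quasiMeasurePreserving_actTorus z)), ?_⟩
  refine (eLpNorm_T_le z α).trans_lt ?_
  refine ENNReal.mul_lt_top ENNReal.ofReal_lt_top (ENNReal.mul_lt_top ?_ (Lp.eLpNorm_lt_top α))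
  exact ENNReal.rpow_lt_top_of_nonneg (by norm_num) (boundConst_ne_top z)

/-! ### The representation, its dual, and little groups -/

/-- The operator `T(g,h)` on `L²(P₁(ℝ) × P₁(ℝ), λ, ℝ)`:
`(T(g,h)α)(x,y) = k_g(x) s_g(x) k_h(y) s_h(y) α(xg, yh)`. -/
def T (z : GG) : L2 →L[ℝ] L2 :=
  LinearMap.mkContinuous
    { toFun := fun α => (memLp_T z α).toLp _
      map_add' := fun α β => by
        rw [← MemLp.toLp_add]
        refine MemLp.toLp_congr _ _ ?_
        filter_upwards [(quasiMeasurePreserving_actTorus z).ae (Lp.coeFn_add α β)] with w hw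
        simp only [hw, Pi.add_apply]
        ring
      map_smul' := fun c α => by
        rw [RingHom.id_apply, ← MemLp.toLp_const_smul]
        refine MemLp.toLp_congr _ _ ?_
        filter_upwards [(quasiMeasurePreserving_actTorus z).ae (Lp.coeFn_smul c α)] with w hw
        simp only [hw, Pi.smul_apply, smul_eq_mul]
        ring }
    (multBound z * (boundConst z ^ (1 / 2 : ℝ)).toReal)
    (fun α => by
      change ‖(memLp_T z α).toLp _‖ ≤ _
      rw [Lp.norm_toLp, Lp.norm_def]
      refine (ENNReal.toReal_mono ?_ (eLpNorm_T_le z α)).trans (le_of_eq ?_)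
      · exact ENNReal.mul_ne_top ENNReal.ofReal_ne_top (ENNReal.mul_ne_top
          (ENNReal.rpow_ne_top_of_nonneg (by norm_num) (boundConst_ne_top z))
          (Lp.eLpNorm_ne_top α))
      · rw [ENNReal.toReal_mul, ENNReal.toReal_mul, ENNReal.toReal_ofReal
          (show 0 ≤ multBound z from mul_nonneg (Real.sqrt_nonneg _) (Real.sqrt_nonneg _)),
          mul_assoc])

/-- The topological dual of `L²(P₁(ℝ) × P₁(ℝ), λ, ℝ)`. -/
abbrev L2Dual : Type := StrongDual ℝ L2

/-- The dual action: `⟨T'(g,h)φ, α⟩ = ⟨φ, T(g⁻¹,h⁻¹)α⟩`. -/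
def T' (z : GG) (φ : L2Dual) : L2Dual := φ.comp (T z⁻¹)

/-- The little group of `φ`: its stabilizer in `SL(2,ℝ) × SL(2,ℝ)` under the dual action. -/
def littleGroup (φ : L2Dual) : Set GG := {z | T' z φ = φ}

/-- The space `A(S)` of all `φ` fixed by every element of `S`. -/
def invariants (S : Subgroup GG) : Submodule ℝ L2Dual where
  carrier := {φ | ∀ z ∈ S, T' z φ = φ}
  add_mem' := fun {φ ψ} hφ hψ z hz => by
    have h : T' z (φ + ψ) = T' z φ + T' z ψ := rfl
    rw [h, hφ z hz, hψ z hz]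
  zero_mem' := fun _ _ => rfl
  smul_mem' := fun c φ hφ z hz => by
    have h : T' z (c • φ) = c • T' z φ := rfl
    rw [h, hφ z hz]

/-- The maximal compact subgroup `SO(2) × SO(2)`, as a subset of `SL(2,ℝ) × SL(2,ℝ)`. -/
def SO2xSO2 : Set GG :=
  {z | (z.1 : Matrix (Fin 2) (Fin 2) ℝ) ∈ Matrix.specialOrthogonalGroup (Fin 2) ℝ ∧
    (z.2 : Matrix (Fin 2) (Fin 2) ℝ) ∈ Matrix.specialOrthogonalGroup (Fin 2) ℝ}

/-- `S` is an infinite potential little group: an infinite closed subgroup of `SO(2) × SO(2)`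
which fixes some nonzero `φ`. -/
structure IsInfinitePotentialLittleGroup (S : Subgroup GG) : Prop where
  le_SO2xSO2 : (S : Set GG) ⊆ SO2xSO2
  isClosed : IsClosed (S : Set GG)
  infinite : (S : Set GG).Infinite
  invariants_ne_bot : invariants S ≠ ⊥

/-- `S` is an (actual) little group: it is the exact stabilizer of some `φ`. -/
def IsLittleGroup (S : Subgroup GG) : Prop := ∃ φ : L2Dual, littleGroup φ = (S : Set GG)

/-- The rotation matrix `[[cos θ, sin θ], [-sin θ, cos θ]]`. -/
def R (θ : ℝ) : SL(2, ℝ) :=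
  ⟨!![Real.cos θ, Real.sin θ; -Real.sin θ, Real.cos θ], by
    rw [Matrix.det_fin_two_of]
    nlinarith [Real.sin_sq_add_cos_sq θ]⟩

lemma R_add (θ η : ℝ) : R (θ + η) = R θ * R η := by
  ext i j
  rw [Matrix.SpecialLinearGroup.coe_mul]
  fin_cases i <;> fin_cases j <;>
    simp [R, Matrix.mul_apply, Fin.sum_univ_two, Real.cos_add, Real.sin_add] <;> ring

lemma R_zero : R 0 = 1 := by
  ext i j
  fin_cases i <;> fin_cases j <;> simp [R]

lemma R_neg (θ : ℝ) : R (-θ) = (R θ)⁻¹ :=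
  eq_inv_of_mul_eq_one_left (by rw [← R_add, neg_add_cancel, R_zero])

/-- The group `H(N, q, p)` of all `(R(qθ), R(pθ + 2πi/N))` with `θ` real; the integer `i` matters
only modulo `N`. -/
def H (N : ℕ) (q p : ℤ) : Subgroup GG where
  carrier := {z | ∃ (θ : ℝ) (i : ℤ), z = (R (q * θ), R (p * θ + 2 * Real.pi / N * i))}
  mul_mem' := by
    rintro _ _ ⟨θ, i, rfl⟩ ⟨η, j, rfl⟩
    refine ⟨θ + η, i + j, ?_⟩
    rw [Prod.mk_mul_mk, ← R_add, ← R_add]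
    push_cast
    congr 2 <;> ring
  one_mem' := ⟨0, 0, by simp [R_zero, Prod.one_eq_mk]⟩
  inv_mem' := by
    rintro _ ⟨θ, i, rfl⟩
    refine ⟨-θ, -i, ?_⟩
    rw [Prod.inv_mk, ← R_neg, ← R_neg]
    push_cast
    congr 2 <;> ring

end HB

end

noncomputable section

namespace HB

/-! The Riesz isomorphism identifies a functional with a function `f` in `L²`. A change of variables
turns the dual action into `f ↦ s k⁻³ · f(xg, yh)`, one factor `s k⁻³` per variable
(`T'_func_eq_iff`). On rotations `k = 1`. The remaining sign `s` says that `f` behaves like a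
function on the product of two unit circles that is odd in each variable. Such functions are spanned
by the characters of bidegree `(m, n)` with `m` and `n` odd, and the rotation `(u, v)` multiplies
such a character by `u^m v^n`.

Hence a nonzero functional fixed by `S` pairs nontrivially with some odd character, and that
character must be trivial on `S` (`exists_odd_characters`). Write its bidegree as `(-dp, dq)` with
`q, p` coprime. An infinite closed `S` inside its kernel has elements arbitrarily close to the
identity. These lie on the line of direction `(q, p)`, so `S` contains the whole one-parameter
group. Thus `S` is determined by the values of the character, and it is the kernel of the character
of bidegree `(-Mp, Mq)` for some `M ∣ d` (`exists_divisor_mem_angles_iff`). By `rot_mem_H_iff` this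
kernel is `H(N, q, p)` whenever `M = N / gcd(N, q)`.

Conversely, for `m, n` odd the function `sign cos(mα + nβ)` has the kernel of the character as its
exact stabilizer (`littleGroup_signFun`). Its absolute value is 1, so an element fixing it has `k_g
k_h = 1` and consists of rotations. A rotation then translates the phase by a constant, and only the
trivial translation preserves the sign of the cosine. The group structure comes from completing `(q,
p)` to an integer matrix of determinant 1. -/

/-! ### The Möbius action in the affine chart -/

@[simp] lemma coord_ofCoord (x : ℝ) : coord (ofCoord x) = x := by
  change x / 1 = x
  simp

lemma ksq_pos (g : SL(2, ℝ)) (x : ℝ) :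
    0 < (x * g 0 1 + g 1 1) ^ 2 + (x * g 0 0 + g 1 0) ^ 2 := by
  have hd := det_eq g
  by_contra! h
  obtain ⟨h1, h2⟩ := (add_eq_zero_iff_of_nonneg (sq_nonneg _) (sq_nonneg _)).1
    (le_antisymm h (by positivity))
  rw [sq_eq_zero_iff] at h1 h2
  have : (1 : ℝ) = 0 := by linear_combination -hd + g 0 0 * h1 - g 0 1 * h2
  exact one_ne_zero this

lemma kFactor_pos (g : SL(2, ℝ)) (x : ℝ) : 0 < kFactor g x :=
  Real.sqrt_pos.2 (div_pos (ksq_pos g x) (by positivity))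

lemma kFactor_sq (g : SL(2, ℝ)) (x : ℝ) : kFactor g x ^ 2 =
    ((x * g 0 1 + g 1 1) ^ 2 + (x * g 0 0 + g 1 0) ^ 2) / (1 + x ^ 2) :=
  Real.sq_sqrt (div_pos (ksq_pos g x) (by positivity)).le

lemma continuous_kFactor (g : SL(2, ℝ)) : Continuous (kFactor g) := by
  unfold kFactor
  refine Real.continuous_sqrt.comp (Continuous.div (by fun_prop) (by fun_prop) fun x => ?_)
  positivity

lemma measurable_kFactor (g : SL(2, ℝ)) : Measurable (kFactor g) :=
  (continuous_kFactor g).measurable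

/-- The coordinate of the image of the point with coordinate `x`. -/
def moebius (g : SL(2, ℝ)) (x : ℝ) : ℝ := (x * g 0 0 + g 1 0) / (x * g 0 1 + g 1 1)

lemma coe_inv_entries (g : SL(2, ℝ)) : (g⁻¹ 0 0 = g 1 1 ∧ g⁻¹ 0 1 = - g 0 1) ∧
    g⁻¹ 1 0 = - g 1 0 ∧ g⁻¹ 1 1 = g 0 0 := by
  have h := Matrix.SpecialLinearGroup.coe_inv g
  rw [Matrix.adjugate_fin_two] at h
  simp [h]

/-- Cocycle relation for the automorphy factor `xb + d`; the behaviour of `k` and `s` under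
inversion follows from it. -/
lemma moebius_denom_inv (g : SL(2, ℝ)) {x : ℝ} (hx : x * g 0 1 + g 1 1 ≠ 0) :
    moebius g x * g⁻¹ 0 1 + g⁻¹ 1 1 = (x * g 0 1 + g 1 1)⁻¹ := by
  obtain ⟨⟨_, h01⟩, _, h11⟩ := coe_inv_entries g
  rw [h01, h11, moebius]
  field_simp
  linear_combination det_eq g

lemma moebius_num_inv (g : SL(2, ℝ)) {x : ℝ} (hx : x * g 0 1 + g 1 1 ≠ 0) :
    moebius g x * g⁻¹ 0 0 + g⁻¹ 1 0 = x * (x * g 0 1 + g 1 1)⁻¹ := by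
  obtain ⟨⟨h00, _⟩, h10, _⟩ := coe_inv_entries g
  rw [h00, h10, moebius]
  field_simp
  linear_combination x * det_eq g

lemma moebius_inv_moebius (g : SL(2, ℝ)) {x : ℝ} (hx : x * g 0 1 + g 1 1 ≠ 0) :
    moebius g⁻¹ (moebius g x) = x := by
  rw [moebius, moebius_denom_inv g hx, moebius_num_inv g hx]
  field_simp

lemma one_add_moebius_sq (g : SL(2, ℝ)) {x : ℝ} (hx : x * g 0 1 + g 1 1 ≠ 0) :
    1 + moebius g x ^ 2 = ((x * g 0 1 + g 1 1) ^ 2 + (x * g 0 0 + g 1 0) ^ 2) /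
      (x * g 0 1 + g 1 1) ^ 2 := by
  rw [moebius]
  field_simp

lemma kFactor_inv_moebius (g : SL(2, ℝ)) {x : ℝ} (hx : x * g 0 1 + g 1 1 ≠ 0) :
    kFactor g⁻¹ (moebius g x) = (kFactor g x)⁻¹ := by
  have h : kFactor g⁻¹ (moebius g x) ^ 2 = ((kFactor g x)⁻¹) ^ 2 := by
    rw [inv_pow, kFactor_sq, kFactor_sq, moebius_denom_inv g hx, moebius_num_inv g hx,
      one_add_moebius_sq g hx]
    have := ksq_pos g x
    field_simp
  exact (pow_left_inj₀ (kFactor_pos _ _).le (inv_pos.2 (kFactor_pos _ _)).le two_ne_zero).1 h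

lemma sFactor_inv_moebius (g : SL(2, ℝ)) {x : ℝ} (hx : x * g 0 1 + g 1 1 ≠ 0) :
    sFactor g⁻¹ (moebius g x) = sFactor g x := by
  rw [sFactor, sFactor, moebius_denom_inv g hx, abs_inv]
  have := abs_pos.2 hx
  field_simp
  rw [sq_abs]

lemma sFactor_mul_self (g : SL(2, ℝ)) {x : ℝ} (hx : x * g 0 1 + g 1 1 ≠ 0) :
    sFactor g x * sFactor g x = 1 := by
  have := abs_pos.2 hx
  rw [sFactor]
  field_simp
  rw [sq_abs]

/-- The points of the affine chart which `g` maps into the affine chart. -/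
def IsRegular (g : SL(2, ℝ)) (P : P1) : Prop :=
  P = ofCoord (coord P) ∧ coord P * g 0 1 + g 1 1 ≠ 0

lemma IsRegular.act_eq {g : SL(2, ℝ)} {P : P1} (h : IsRegular g P) :
    act g P = ofCoord (moebius g (coord P)) := by
  conv_lhs => rw [h.1]
  exact act_ofCoord g _ h.2

lemma IsRegular.coord_act {g : SL(2, ℝ)} {P : P1} (h : IsRegular g P) :
    coord (act g P) = moebius g (coord P) := by
  rw [h.act_eq, coord_ofCoord]

lemma IsRegular.inv_act {g : SL(2, ℝ)} {P : P1} (h : IsRegular g P) :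
    act g⁻¹ (act g P) = P := by
  rw [h.act_eq, act_ofCoord]
  · have := moebius_inv_moebius g h.2
    rw [moebius] at this
    rw [this, ← h.1]
  · rw [moebius_denom_inv g h.2]
    exact inv_ne_zero h.2

/-- The measure `dx / (1 + x²)` on the line. -/
def cauchyMeasure : Measure ℝ := volume.withDensity fun x => ENNReal.ofReal (1 / (1 + x ^ 2))

lemma measurable_cauchyDensity : Measurable fun x : ℝ => ENNReal.ofReal (1 / (1 + x ^ 2)) := by
  fun_prop

lemma lam1_eq_map : lam1 = Measure.map ofCoord cauchyMeasure := by
  ext s hs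
  rw [Measure.map_apply measurable_ofCoord hs, ← lintegral_indicator_one hs,
    lintegral_lam1 (measurable_one.indicator hs), cauchyMeasure,
    withDensity_apply _ (measurable_ofCoord hs),
    ← lintegral_indicator (measurable_ofCoord hs)]
  refine lintegral_congr fun x => ?_
  by_cases hx : ofCoord x ∈ s
  · simp [hx]
  · simp [hx]

/-- The equation singles out the affine points: at infinity `coord` takes the default value 0, and
`ofCoord 0` is a different point. On nonzero vectors the condition reads `x₂ ≠ 0`. -/
lemma measurable_finite : MeasurableSet {P : P1 | P = ofCoord (coord P)} := by
  have h : MeasurableSet {v : {v : Fin 2 → ℝ // v ≠ 0} | v.1 1 ≠ 0} :=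
    (((measurable_pi_apply 1).comp measurable_subtype_coe) (measurableSet_singleton 0)).compl
  refine measurableSet_quotient.2 ?_
  convert h using 1
  ext v
  change (Projectivization.mk ℝ v.1 v.2 : P1) = ofCoord (v.1 0 / v.1 1) ↔ v.1 1 ≠ 0
  rw [ofCoord, Projectivization.mk_eq_mk_iff']
  constructor
  · rintro ⟨a, ha⟩ h1
    have h0 := congrFun ha 0
    have h1' := congrFun ha 1
    simp [h1] at h0 h1'
    apply v.2
    ext i
    fin_cases i
    · simp [← h0]
    · simp [h1]
  · intro h1
    refine ⟨v.1 1, ?_⟩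
    ext i
    fin_cases i
    · simp; field_simp
    · simp

lemma ae_isRegular (g : SL(2, ℝ)) : ∀ᵐ P ∂lam1, IsRegular g P := by
  have hm : MeasurableSet {P : P1 | IsRegular g P} := by
    refine measurable_finite.inter ?_
    have : Measurable fun P : P1 => coord P * g 0 1 + g 1 1 :=
      (measurable_coord.mul_const _).add_const _
    exact (this (measurableSet_singleton 0)).compl
  rw [lam1_eq_map, ae_map_iff measurable_ofCoord.aemeasurable hm, cauchyMeasure]
  refine (withDensity_absolutelyContinuous _ _).ae_le ?_
  refine mem_ae_iff.2 ?_
  convert pole_null g using 2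
  ext x
  simp [IsRegular]

lemma ae_isRegular_prod (z : GG) : ∀ᵐ w ∂lam, IsRegular z.1 w.1 ∧ IsRegular z.2 w.2 := by
  filter_upwards [Measure.quasiMeasurePreserving_fst.ae (ae_isRegular z.1),
    Measure.quasiMeasurePreserving_snd.ae (ae_isRegular z.2)] with w h1 h2 using ⟨h1, h2⟩

instance : SFinite cauchyMeasure := by unfold cauchyMeasure; infer_instance

lemma lam_eq_map : lam = Measure.map (Prod.map ofCoord ofCoord)
    (cauchyMeasure.prod cauchyMeasure) := by
  rw [lam, lam1_eq_map, Measure.map_prod_map _ _ measurable_ofCoord measurable_ofCoord]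

lemma volume_ac_cauchyMeasure : (volume : Measure ℝ) ≪ cauchyMeasure :=
  withDensity_absolutelyContinuous' measurable_cauchyDensity.aemeasurable
    (Filter.Eventually.of_forall fun x => by
      simp only [ne_eq, ENNReal.ofReal_eq_zero, not_le]; positivity)

/-- The density `1 / (1 + x²)` never vanishes, so Lebesgue measure on the chart sees no more than
`lam` does. Continuity arguments can then be run in the plane. -/
lemma ae_coord_of_ae {p : P1 × P1 → Prop} (h : ∀ᵐ w ∂lam, p w) :
    ∀ᵐ x : ℝ × ℝ, p (ofCoord x.1, ofCoord x.2) := by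
  rw [lam_eq_map] at h
  have h' := ae_of_ae_map (measurable_ofCoord.prodMap measurable_ofCoord).aemeasurable h
  exact (volume_ac_cauchyMeasure.prod volume_ac_cauchyMeasure).ae_le h'

/-! ### Change of variables -/

/-- The derivative `(xb + d)⁻²`, weighted by the ratio of the densities `1 / (1 + x²)` at the image
and at the point, is exactly `k⁻²`. -/
lemma lintegral_act_eq (g : SL(2, ℝ)) {f : P1 → ℝ≥0∞} (hf : Measurable f) :
    ∫⁻ P, ENNReal.ofReal ((kFactor g (coord P) ^ 2)⁻¹) * f (act g P) ∂lam1 = ∫⁻ P, f P ∂lam1 := by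
  set s : Set ℝ := {x : ℝ | x * g 0 1 + g 1 1 ≠ 0} with hs
  have hms : MeasurableSet s := by
    have : Measurable fun x : ℝ => x * g 0 1 + g 1 1 := by fun_prop
    exact (this (measurableSet_singleton 0)).compl
  have hae : s =ᵐ[volume] Set.univ := by
    rw [ae_eq_univ]
    convert pole_null g using 2
    ext x; simp [hs]
  have hd := det_eq g
  have hderiv : ∀ x ∈ s, HasDerivWithinAt (moebius g) (1 / (x * g 0 1 + g 1 1) ^ 2) s x := by
    intro x hx
    have h1 : HasDerivAt (fun x : ℝ => x * g 0 0 + g 1 0) (g 0 0) x := by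
      simpa using ((hasDerivAt_id x).mul_const (g 0 0)).add_const (g 1 0)
    have h2 : HasDerivAt (fun x : ℝ => x * g 0 1 + g 1 1) (g 0 1) x := by
      simpa using ((hasDerivAt_id x).mul_const (g 0 1)).add_const (g 1 1)
    have h3 := h1.div h2 hx
    refine (h3.congr_deriv ?_).hasDerivWithinAt
    congr 1
    linear_combination hd
  have hinj : Set.InjOn (moebius g) s := by
    intro x hx y hy h
    rw [← moebius_inv_moebius g hx, h, moebius_inv_moebius g hy]
  -- The image misses at most the pole of `g⁻¹`: any other point has a preimage under the inverse
  -- map.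
  have himage : moebius g '' s =ᵐ[volume] Set.univ := by
    rw [ae_eq_univ]
    refine measure_mono_null ?_ (pole_null g⁻¹)
    intro y hy
    by_contra hy'
    refine hy ⟨moebius g⁻¹ y, ?_, ?_⟩
    · have := moebius_denom_inv g⁻¹ hy'
      rw [inv_inv] at this
      rw [hs, Set.mem_ofPred_eq, this]
      exact inv_ne_zero hy'
    · have := moebius_inv_moebius g⁻¹ hy'
      rwa [inv_inv] at this
  have key := lintegral_image_eq_lintegral_abs_deriv_mul hms hderiv hinj
    (fun y => ENNReal.ofReal (1 / (1 + y ^ 2)) * f (ofCoord y))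
  have hmk : Measurable fun P : P1 => ENNReal.ofReal ((kFactor g (coord P) ^ 2)⁻¹) :=
    ((((measurable_kFactor g).comp measurable_coord).pow_const 2).inv).ennreal_ofReal
  have hmf : Measurable fun P : P1 =>
      ENNReal.ofReal ((kFactor g (coord P) ^ 2)⁻¹) * f (act g P) :=
    hmk.mul (hf.comp (measurable_act g))
  rw [lintegral_lam1 hmf, lintegral_lam1 hf,
    ← setLIntegral_univ, ← setLIntegral_congr hae, ← setLIntegral_univ (fun x =>
      ENNReal.ofReal (1 / (1 + x ^ 2)) * f (ofCoord x)), ← setLIntegral_congr himage, key]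
  refine setLIntegral_congr_fun hms fun x hx => ?_
  have hx' : x * g 0 1 + g 1 1 ≠ 0 := hx
  rw [coord_ofCoord, act_ofCoord g x hx, ← moebius, ← mul_assoc, ← mul_assoc,
    ← ENNReal.ofReal_mul (by positivity), ← ENNReal.ofReal_mul (abs_nonneg _)]
  congr 2
  have := ksq_pos g x
  rw [kFactor_sq, abs_of_nonneg (by positivity), one_add_moebius_sq g hx']
  field_simp

/-- The density `k⁻²` on the projective line. -/
def jac1 (g : SL(2, ℝ)) (P : P1) : ℝ≥0∞ := ENNReal.ofReal ((kFactor g (coord P) ^ 2)⁻¹)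

/-- The density `(k_g k_h)⁻²` on the torus. -/
def jac (z : GG) (w : P1 × P1) : ℝ :=
  (kFactor z.1 (coord w.1) ^ 2)⁻¹ * (kFactor z.2 (coord w.2) ^ 2)⁻¹

lemma measurable_jac1 (g : SL(2, ℝ)) : Measurable (jac1 g) :=
  ((((measurable_kFactor g).comp measurable_coord).pow_const 2).inv).ennreal_ofReal

lemma jac_pos (z : GG) (w : P1 × P1) : 0 < jac z w :=
  mul_pos (inv_pos.2 (pow_pos (kFactor_pos _ _) 2)) (inv_pos.2 (pow_pos (kFactor_pos _ _) 2))

lemma measurable_jac (z : GG) : Measurable (jac z) :=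
  ((((measurable_kFactor _).comp (measurable_coord.comp measurable_fst)).pow_const 2).inv).mul
    ((((measurable_kFactor _).comp (measurable_coord.comp measurable_snd)).pow_const 2).inv)

lemma map_act_withDensity (g : SL(2, ℝ)) :
    Measure.map (act g) (lam1.withDensity (jac1 g)) = lam1 := by
  ext s hs
  rw [Measure.map_apply (measurable_act g) hs, withDensity_apply _ (measurable_act g hs),
    ← lintegral_indicator (measurable_act g hs), ← lintegral_indicator_one hs,
    ← lintegral_act_eq g (measurable_one.indicator hs)]
  refine lintegral_congr fun P => ?_
  by_cases hx : act g P ∈ s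
  · simp [hx, jac1]
  · simp [hx]

lemma map_actTorus_withDensity (z : GG) :
    Measure.map (actTorus z) (lam.withDensity fun w => ENNReal.ofReal (jac z w)) = lam := by
  have h : lam.withDensity (fun w => ENNReal.ofReal (jac z w)) =
      (lam1.withDensity (jac1 z.1)).prod (lam1.withDensity (jac1 z.2)) := by
    rw [prod_withDensity (measurable_jac1 _) (measurable_jac1 _), lam]
    congr 1
    ext w
    rw [jac, ENNReal.ofReal_mul (inv_nonneg.2 (sq_nonneg _))]
    rfl
  rw [h, actTorus, ← Measure.map_prod_map _ _ (measurable_act _) (measurable_act _),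
    map_act_withDensity, map_act_withDensity, lam]

lemma integral_jac_mul (z : GG) {F : P1 × P1 → ℝ} (hF : AEStronglyMeasurable F lam) :
    ∫ w, jac z w * F (actTorus z w) ∂lam = ∫ w, F w ∂lam := by
  conv_rhs => rw [← map_actTorus_withDensity z]
  rw [integral_map (measurable_actTorus z).aemeasurable (by rwa [map_actTorus_withDensity]),
    integral_withDensity_eq_integral_toReal_smul (measurable_jac z).ennreal_ofReal
      (Filter.Eventually.of_forall fun _ => ENNReal.ofReal_lt_top)]
  refine integral_congr_ae (Filter.Eventually.of_forall fun w => ?_)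
  simp [ENNReal.toReal_ofReal (jac_pos z w).le]

lemma integrable_jac_mul (z : GG) {F : P1 × P1 → ℝ} (hF : Integrable F lam) :
    Integrable (fun w => jac z w * F (actTorus z w)) lam := by
  have h : Integrable F (Measure.map (actTorus z)
      (lam.withDensity fun w => ENNReal.ofReal (jac z w))) := by
    rwa [map_actTorus_withDensity]
  have h2 := (integrable_map_measure (h.1) (measurable_actTorus z).aemeasurable).1 h
  have h3 := (integrable_withDensity_iff_integrable_smul' (measurable_jac z).ennreal_ofReal
      (Filter.Eventually.of_forall fun _ => ENNReal.ofReal_lt_top)).1 h2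
  refine h3.congr (Filter.Eventually.of_forall fun w => ?_)
  simp [ENNReal.toReal_ofReal (jac_pos z w).le]

/-! ### The dual action on densities -/

/-- The multiplier `s_g k_g⁻³` of the dual action. -/
def dualFactor (g : SL(2, ℝ)) (x : ℝ) : ℝ := sFactor g x * (kFactor g x ^ 3)⁻¹

/-- The multiplier of the dual action on the torus. -/
def dualMult (z : GG) (w : P1 × P1) : ℝ :=
  dualFactor z.1 (coord w.1) * dualFactor z.2 (coord w.2)

/-- The Jacobian contributes `k⁻²`, and the multiplier of `g⁻¹` at the image point contributes `k⁻¹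
s`. -/
lemma dualFactor_eq (g : SL(2, ℝ)) {P : P1} (h : IsRegular g P) :
    (kFactor g (coord P) ^ 2)⁻¹ * (kFactor g⁻¹ (coord (act g P)) * sFactor g⁻¹ (coord (act g P))) =
      dualFactor g (coord P) := by
  rw [h.coord_act, kFactor_inv_moebius g h.2, sFactor_inv_moebius g h.2, dualFactor]
  have := kFactor_pos g (coord P)
  field_simp

lemma jac_mul_multiplier (z : GG) : ∀ᵐ w ∂lam,
    jac z w * multiplier z⁻¹ (actTorus z w) = dualMult z w := by
  filter_upwards [ae_isRegular_prod z] with w hw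
  rw [dualMult, ← dualFactor_eq z.1 hw.1, ← dualFactor_eq z.2 hw.2, jac, multiplier]
  simp only [actTorus, Prod.map, Prod.fst_inv, Prod.snd_inv]
  ring

lemma actTorus_inv_actTorus (z : GG) : ∀ᵐ w ∂lam, actTorus z⁻¹ (actTorus z w) = w := by
  filter_upwards [ae_isRegular_prod z] with w hw
  simp only [actTorus, Prod.map, Prod.fst_inv, Prod.snd_inv]
  rw [hw.1.inv_act, hw.2.inv_act]

/-- The functional `α ↦ ∫ f α dλ`. -/
def func (f : L2) : L2Dual := InnerProductSpace.toDual ℝ L2 f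

lemma func_apply (f α : L2) : func f α = ∫ w, f w * α w ∂lam := by
  rw [func, InnerProductSpace.toDual_apply_apply, MeasureTheory.L2.inner_def]
  refine integral_congr_ae (Filter.Eventually.of_forall fun w => ?_)
  simp [mul_comm]

lemma T_coeFn (z : GG) (α : L2) :
    T z α =ᵐ[lam] fun w => multiplier z w * α (actTorus z w) :=
  (memLp_T z α).coeFn_toLp

lemma T'_func_apply (z : GG) (f α : L2) :
    T' z (func f) α = ∫ w, dualMult z w * f (actTorus z w) * α w ∂lam := by
  have h1 : T' z (func f) α = func f (T z⁻¹ α) := rfl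
  rw [h1, func_apply]
  have hm : AEStronglyMeasurable (fun w => f w * T z⁻¹ α w) lam :=
    (Lp.aestronglyMeasurable f).mul (Lp.aestronglyMeasurable _)
  rw [← integral_jac_mul z hm]
  refine integral_congr_ae ?_
  filter_upwards [(quasiMeasurePreserving_actTorus z).ae (T_coeFn z⁻¹ α), jac_mul_multiplier z,
    actTorus_inv_actTorus z] with w h1 h2 h3
  rw [h1, h3, ← h2]
  ring

/-- The integrand is the Jacobian times the pullback of a bounded multiplier times `f`, so no
separate bound on `dualMult` is needed. -/
lemma integrable_dualMult_mul (z : GG) (f : L2) :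
    Integrable (fun w => dualMult z w * f (actTorus z w)) lam := by
  have hf : Integrable f lam := (Lp.memLp f).integrable (by norm_num)
  have h1 : Integrable (fun w => multiplier z⁻¹ w * f w) lam :=
    hf.bdd_mul (measurable_multiplier z⁻¹).aestronglyMeasurable
      (Filter.Eventually.of_forall (norm_multiplier_le z⁻¹))
  refine (integrable_jac_mul z h1).congr ?_
  filter_upwards [jac_mul_multiplier z] with w hw
  rw [← hw]
  ring

theorem T'_func_eq_iff (z : GG) (f : L2) :
    T' z (func f) = func f ↔ ∀ᵐ w ∂lam, dualMult z w * f (actTorus z w) = f w := by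
  constructor
  · intro h
    refine ae_eq_of_forall_setIntegral_eq_of_sigmaFinite (μ := lam)
      (fun s _ _ => (integrable_dualMult_mul z f).integrableOn)
      (fun s _ _ => ((Lp.memLp f).integrable (by norm_num)).integrableOn) ?_
    intro s hs _
    -- Equality of functionals is tested on indicators, which turns it into equality of all set
    -- integrals.
    have h1 := congrArg (fun φ => φ (indicatorConstLp 2 hs (measure_ne_top lam s) (1 : ℝ))) h
    simp only [T'_func_apply, func_apply] at h1
    have e : ∀ F : P1 × P1 → ℝ, ∫ w, F w * (indicatorConstLp 2 hs (measure_ne_top lam s) (1 : ℝ)) w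
        ∂lam = ∫ w in s, F w ∂lam := by
      intro F
      rw [← integral_indicator hs]
      refine integral_congr_ae ?_
      filter_upwards [indicatorConstLp_coeFn (p := 2) (hs := hs)
        (hμs := measure_ne_top lam s) (c := (1 : ℝ))] with w hw
      rw [hw]
      by_cases hws : w ∈ s <;> simp [hws]
    rwa [e, e] at h1
  · intro h
    ext α
    rw [T'_func_apply, func_apply]
    refine integral_congr_ae ?_
    filter_upwards [h] with w hw
    rw [hw]

lemma exists_func_eq (φ : L2Dual) : ∃ f, φ = func f :=
  ⟨(InnerProductSpace.toDual ℝ L2).symm φ, by simp [func]⟩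

/-! ### Rotations -/

lemma circle_re_sq_add_im_sq (u : Circle) : (u : ℂ).re ^ 2 + (u : ℂ).im ^ 2 = 1 := by
  have := Circle.normSq_coe u
  rw [Complex.normSq_apply] at this
  linarith

/-- The rotation attached to a point of the circle. -/
def circleRotation (u : Circle) : SL(2, ℝ) :=
  ⟨!![(u : ℂ).re, (u : ℂ).im; -(u : ℂ).im, (u : ℂ).re], by
    rw [Matrix.det_fin_two_of]
    linarith [circle_re_sq_add_im_sq u]⟩

/-- The rotation attached to a point of the circle, as a homomorphism. -/
def rot : Circle →* SL(2, ℝ) :=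
  MonoidHom.mk' circleRotation fun u v => by
    ext i j
    rw [Matrix.SpecialLinearGroup.coe_mul]
    fin_cases i <;> fin_cases j <;>
      simp [circleRotation, Matrix.mul_apply, Fin.sum_univ_two] <;> ring

lemma rot_00 (u : Circle) : rot u 0 0 = (u : ℂ).re := rfl
lemma rot_01 (u : Circle) : rot u 0 1 = (u : ℂ).im := rfl
lemma rot_10 (u : Circle) : rot u 1 0 = -(u : ℂ).im := rfl
lemma rot_11 (u : Circle) : rot u 1 1 = (u : ℂ).re := rfl

lemma R_eq_rot (θ : ℝ) : R θ = rot (Circle.exp θ) := by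
  ext i j
  fin_cases i <;> fin_cases j <;>
    simp [R, rot_00, rot_01, rot_10, rot_11, Circle.coe_exp, Complex.exp_ofReal_mul_I_re,
      Complex.exp_ofReal_mul_I_im]

lemma rot_injective : Function.Injective rot := by
  intro u v h
  refine Circle.ext (Complex.ext ?_ ?_)
  · rw [← rot_00, h, rot_00]
  · rw [← rot_01, h, rot_01]

lemma continuous_rot : Continuous rot := by
  refine continuous_induced_rng.2 (continuous_matrix fun i j => ?_)
  have h1 : Continuous fun u : Circle => (u : ℂ).re := Complex.continuous_re.comp
    continuous_subtype_val
  have h2 : Continuous fun u : Circle => (u : ℂ).im := Complex.continuous_im.comp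
    continuous_subtype_val
  fin_cases i <;> fin_cases j
  · exact h1
  · exact h2
  · exact h2.neg
  · exact h1

lemma exists_rot_eq (g : SL(2, ℝ)) (h1 : g 1 1 = g 0 0) (h2 : g 1 0 = -g 0 1) :
    ∃ u, g = rot u := by
  have hd := det_eq g
  have hn : ‖(⟨g 0 0, g 0 1⟩ : ℂ)‖ = 1 := by
    rw [Complex.norm_def, Complex.normSq_mk, Real.sqrt_eq_one]
    rw [h1, h2] at hd
    linarith
  refine ⟨⟨⟨g 0 0, g 0 1⟩, mem_sphere_zero_iff_norm.2 hn⟩, ?_⟩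
  ext i j
  fin_cases i <;> fin_cases j
  · rfl
  · rfl
  · exact h2
  · exact h1

lemma rot_mem_specialOrthogonalGroup (u : Circle) :
    (rot u : Matrix (Fin 2) (Fin 2) ℝ) ∈ Matrix.specialOrthogonalGroup (Fin 2) ℝ := by
  rw [mem_specialOrthogonalGroup_iff]
  refine ⟨(mem_orthogonalGroup_iff _ _).2 ?_, (rot u).det_coe⟩
  have := circle_re_sq_add_im_sq u
  ext i j
  fin_cases i <;> fin_cases j <;>
    simp [Matrix.mul_apply, Fin.sum_univ_two, rot_00, rot_01, rot_10, rot_11] <;> linarith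

/-- By Lagrange's identity, the product of the squared row norms is `det² + (dot product)² = 1`. So
`C = 1` and the rows are orthonormal. -/
lemma exists_rot_eq_of_row_norms (g : SL(2, ℝ)) {C : ℝ}
    (h0 : g 0 0 ^ 2 + g 0 1 ^ 2 = C) (h1 : g 1 0 ^ 2 + g 1 1 ^ 2 = C)
    (h2 : g 0 0 * g 1 0 + g 0 1 * g 1 1 = 0) : ∃ u, g = rot u := by
  have hd := det_eq g
  have hC0 : 0 ≤ C := by rw [← h0]; positivity
  have hC2 : C ^ 2 = 1 := by
    linear_combination (-C) * h0 - (g 0 0 ^ 2 + g 0 1 ^ 2) * h1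
      + (g 0 0 * g 1 0 + g 0 1 * g 1 1) * h2 + (g 0 0 * g 1 1 - g 0 1 * g 1 0 + 1) * hd
  have hC : C = 1 := by nlinarith
  subst hC
  refine exists_rot_eq g ?_ ?_
  · linear_combination (-g 1 1) * h0 + g 0 1 * h2 + g 0 0 * hd
  · linear_combination (-g 1 0) * h0 + g 0 0 * h2 - g 0 1 * hd

lemma exists_rot_eq_of_mem_specialOrthogonalGroup {g : SL(2, ℝ)}
    (h : (g : Matrix (Fin 2) (Fin 2) ℝ) ∈ Matrix.specialOrthogonalGroup (Fin 2) ℝ) :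
    ∃ u, g = rot u := by
  have h' := (mem_orthogonalGroup_iff _ _).1 (mem_specialOrthogonalGroup_iff.1 h).1
  have h00 := congrFun (congrFun h' 0) 0
  have h01 := congrFun (congrFun h' 0) 1
  have h11 := congrFun (congrFun h' 1) 1
  simp only [Matrix.mul_apply, Fin.sum_univ_two, Matrix.transpose_apply, Matrix.one_apply_eq,
    Matrix.one_apply_ne (zero_ne_one' (Fin 2))] at h00 h01 h11
  exact exists_rot_eq_of_row_norms g (C := 1) (by linarith) (by linarith) h01

lemma kFactor_rot (u : Circle) (x : ℝ) : kFactor (rot u) x = 1 := by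
  have h : kFactor (rot u) x ^ 2 = 1 := by
    rw [kFactor_sq, rot_00, rot_01, rot_10, rot_11, div_eq_one_iff_eq (by positivity)]
    linear_combination (1 + x ^ 2) * circle_re_sq_add_im_sq u
  nlinarith [kFactor_pos (rot u) x]

/-! ### The unit vector over a point of the line -/

lemma add_I_ne_zero (x : ℝ) : (x : ℂ) + Complex.I ≠ 0 := by
  intro h
  simpa using congrArg Complex.im h

/-- The unit vector `(x + i) / |x + i|`. -/
def cay (x : ℝ) : Circle := ⟨((x : ℂ) + Complex.I) / ‖(x : ℂ) + Complex.I‖, by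
  rw [Submonoid.unitSphere, Submonoid.mem_mk, Subsemigroup.mem_mk, mem_sphere_zero_iff_norm]
  simp [add_I_ne_zero x]⟩

lemma coe_cay (x : ℝ) : (cay x : ℂ) = ((x : ℂ) + Complex.I) / ‖(x : ℂ) + Complex.I‖ := rfl

lemma continuous_cay : Continuous cay := by
  refine Continuous.subtype_mk (Continuous.div (by fun_prop) (by fun_prop) fun x => ?_) _
  simpa using add_I_ne_zero x

lemma cay_of_eq_mul {x r : ℝ} {u : Circle} (hr : 0 < r) (h : (x : ℂ) + Complex.I = r * u) :
    cay x = u := by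
  refine Circle.ext ?_
  rw [coe_cay, h]
  have : (r : ℂ) ≠ 0 := by exact_mod_cast hr.ne'
  simp only [norm_mul, Complex.norm_real, Circle.norm_coe, Real.norm_of_nonneg hr.le, mul_one]
  field_simp

lemma add_I_eq (x : ℝ) : (x : ℂ) + Complex.I = (‖(x : ℂ) + Complex.I‖ : ℝ) * cay x := by
  have : ((‖(x : ℂ) + Complex.I‖ : ℝ) : ℂ) ≠ 0 := by simpa using add_I_ne_zero x
  rw [coe_cay]
  field_simp

lemma moebius_rot_add_I (u : Circle) {x : ℝ} (hx : x * rot u 0 1 + rot u 1 1 ≠ 0) :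
    (moebius (rot u) x : ℂ) + Complex.I =
      ((x * rot u 0 1 + rot u 1 1 : ℝ) : ℂ)⁻¹ * (((x : ℂ) + Complex.I) * u) := by
  have h' : ((x * rot u 0 1 + rot u 1 1 : ℝ) : ℂ) ≠ 0 := by exact_mod_cast hx
  rw [eq_inv_mul_iff_mul_eq₀ h', moebius]
  have h3 : ((x * rot u 0 1 + rot u 1 1 : ℝ) : ℂ) *
      (((x * rot u 0 0 + rot u 1 0) / (x * rot u 0 1 + rot u 1 1) : ℝ) : ℂ) =
      ((x * rot u 0 0 + rot u 1 0 : ℝ) : ℂ) := by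
    rw [← Complex.ofReal_mul, mul_div_cancel₀ _ hx]
  rw [mul_add, h3, rot_00, rot_01, rot_10, rot_11]
  apply Complex.ext
  · simp; ring
  · simp

/-- `cay` picks the unit vector in the open upper half plane over a point of the line. Rotating that
vector by `u` may leave the half plane, and `s` is the sign needed to come back. -/
lemma cay_moebius_rot (u : Circle) {x : ℝ} (hx : x * rot u 0 1 + rot u 1 1 ≠ 0) :
    (sFactor (rot u) x = 1 ∧ cay (moebius (rot u) x) = cay x * u) ∨
      (sFactor (rot u) x = -1 ∧ cay (moebius (rot u) x) = -(cay x * u)) := by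
  have h := moebius_rot_add_I u hx
  have hn : 0 < ‖(x : ℂ) + Complex.I‖ := norm_pos_iff.2 (add_I_ne_zero x)
  rw [sFactor]
  rcases hx.lt_or_gt with hlt | hlt
  · right
    refine ⟨?_, cay_of_eq_mul (r := -(x * rot u 0 1 + rot u 1 1)⁻¹ * ‖(x : ℂ) + Complex.I‖) ?_ ?_⟩
    · rw [abs_of_neg hlt, div_neg, div_self hx]
    · exact mul_pos (neg_pos.2 (inv_lt_zero.2 hlt)) hn
    · rw [h]
      conv_lhs => rw [add_I_eq x]
      push_cast
      ring
  · left
    refine ⟨?_, cay_of_eq_mul (r := (x * rot u 0 1 + rot u 1 1)⁻¹ * ‖(x : ℂ) + Complex.I‖) ?_ ?_⟩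
    · rw [abs_of_pos hlt, div_self hx]
    · exact mul_pos (inv_pos.2 hlt) hn
    · rw [h]
      conv_lhs => rw [add_I_eq x]
      push_cast
      ring

lemma cay_cot {u : Circle} (hu : (u : ℂ).im ≠ 0) :
    ∃ x, cay x = u ∨ cay x = -u := by
  refine ⟨(u : ℂ).re / (u : ℂ).im, ?_⟩
  have h : (((u : ℂ).re / (u : ℂ).im : ℝ) : ℂ) + Complex.I = ((u : ℂ).im⁻¹ : ℝ) * u := by
    apply Complex.ext
    · rw [Complex.re_ofReal_mul]; simp; ring
    · rw [Complex.im_ofReal_mul]; simp [hu]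
  rcases hu.lt_or_gt with hlt | hlt
  · right
    refine cay_of_eq_mul (r := -(u : ℂ).im⁻¹) (neg_pos.2 (inv_lt_zero.2 hlt)) ?_
    rw [h]
    push_cast
    ring
  · left
    exact cay_of_eq_mul (inv_pos.2 hlt) h

/-- The character of bidegree `(m, n)`, as a function of the projective coordinates. -/
def bichar (m n : ℤ) (x : ℝ × ℝ) : Circle := cay x.1 ^ m * cay x.2 ^ n

lemma continuous_bichar (m n : ℤ) : Continuous (bichar m n) :=
  ((continuous_cay.comp continuous_fst).zpow m).mul ((continuous_cay.comp continuous_snd).zpow n)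

/-- The pair of projective coordinates. -/
def coords (w : P1 × P1) : ℝ × ℝ := (coord w.1, coord w.2)

lemma measurable_coords : Measurable coords :=
  (measurable_coord.comp measurable_fst).prodMk (measurable_coord.comp measurable_snd)

/-- The sign `s_g s_h`. -/
def signMult (z : GG) (w : P1 × P1) : ℝ := sFactor z.1 (coord w.1) * sFactor z.2 (coord w.2)

/-- Because `m` and `n` are odd, each change of representative flips the sign of the character, in
step with `s_g` and `s_h`. The two signs cancel in the action. -/
lemma bichar_act_rot {m n : ℤ} (hm : Odd m) (hn : Odd n) (u v : Circle) {w : P1 × P1}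
    (h1 : IsRegular (rot u) w.1) (h2 : IsRegular (rot v) w.2) :
    (signMult (rot u, rot v) w = 1 ∧ bichar m n (coords (actTorus (rot u, rot v) w)) =
      bichar m n (coords w) * (u ^ m * v ^ n)) ∨
    (signMult (rot u, rot v) w = -1 ∧ bichar m n (coords (actTorus (rot u, rot v) w)) =
      -(bichar m n (coords w) * (u ^ m * v ^ n))) := by
  simp only [bichar, coords, actTorus, Prod.map, h1.coord_act, h2.coord_act, signMult]
  rcases cay_moebius_rot u h1.2 with ⟨a, b⟩ | ⟨a, b⟩ <;>
  rcases cay_moebius_rot v h2.2 with ⟨c, d⟩ | ⟨c, d⟩ <;>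
  rw [a, b, c, d] <;>
  simp only [hm.neg_zpow, hn.neg_zpow, mul_zpow]
  · left
    refine ⟨by norm_num, ?_⟩
    rw [mul_mul_mul_comm]
  · right
    refine ⟨by norm_num, ?_⟩
    rw [mul_neg, mul_mul_mul_comm]
  · right
    refine ⟨by norm_num, ?_⟩
    rw [neg_mul, mul_mul_mul_comm]
  · left
    refine ⟨by norm_num, ?_⟩
    rw [neg_mul_neg, mul_mul_mul_comm]

lemma dualMult_rot (u v : Circle) (w : P1 × P1) :
    dualMult (rot u, rot v) w = signMult (rot u, rot v) w := by
  simp [dualMult, dualFactor, signMult, kFactor_rot]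

lemma multiplier_rot (u v : Circle) (w : P1 × P1) :
    multiplier (rot u, rot v) w = signMult (rot u, rot v) w := by
  simp [multiplier, signMult, kFactor_rot]

/-! ### A function with a prescribed stabilizer -/

open Classical in
/-- The sign of a point of the circle: `1` on a half-open half circle, `-1` on the other half. -/
def halfSign (z : Circle) : ℝ :=
  if 0 < (z : ℂ).re ∨ ((z : ℂ).re = 0 ∧ 0 < (z : ℂ).im) then 1 else -1

/-- The half-open half circle meets each antipodal pair exactly once, so oddness holds at every
point without exception. -/
lemma halfSign_neg (z : Circle) : halfSign (-z) = -halfSign z := by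
  have hz := circle_re_sq_add_im_sq z
  have hn : ¬ ((z : ℂ).re = 0 ∧ (z : ℂ).im = 0) := by
    rintro ⟨h1, h2⟩
    simp [h1, h2] at hz
  have hre : ((-z : Circle) : ℂ).re = -(z : ℂ).re := rfl
  have him : ((-z : Circle) : ℂ).im = -(z : ℂ).im := rfl
  by_cases h1 : 0 < (z : ℂ).re ∨ ((z : ℂ).re = 0 ∧ 0 < (z : ℂ).im)
  · have a : halfSign z = 1 := if_pos h1
    have b : halfSign (-z) = -1 := if_neg (by
      rw [hre, him]
      rintro (h2 | ⟨h2, h2'⟩) <;> rcases h1 with h1 | ⟨h1, h1'⟩ <;> linarith)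
    rw [a, b]
  · have a : halfSign z = -1 := if_neg h1
    have b : halfSign (-z) = 1 := if_pos (by
      rw [hre, him]
      push Not at h1
      rcases h1.1.lt_or_eq with h | h
      · left; linarith
      · right
        refine ⟨by linarith, ?_⟩
        rcases (h1.2 h).lt_or_eq with h' | h'
        · linarith
        · exact absurd ⟨h, h'⟩ hn)
    rw [a, b, neg_neg]

lemma abs_halfSign (z : Circle) : |halfSign z| = 1 := by
  unfold halfSign
  split_ifs <;> simp

lemma halfSign_ne_of_re_mul_neg {z w : Circle} (h : (z : ℂ).re * (w : ℂ).re < 0) :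
    halfSign z ≠ halfSign w := by
  rcases mul_neg_iff.1 h with ⟨h1, h2⟩ | ⟨h1, h2⟩
  · have a : halfSign z = 1 := if_pos (Or.inl h1)
    have b : halfSign w = -1 := if_neg (by
      rintro (h | h) <;> linarith [h])
    rw [a, b]; norm_num
  · have a : halfSign w = 1 := if_pos (Or.inl h2)
    have b : halfSign z = -1 := if_neg (by
      rintro (h | h) <;> linarith [h])
    rw [a, b]; norm_num

lemma measurable_halfSign_bichar (m n : ℤ) : Measurable fun x => halfSign (bichar m n x) := by
  have hc : Continuous fun x => (bichar m n x : ℂ) :=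
    continuous_subtype_val.comp (continuous_bichar m n)
  have h1 : Measurable fun x => (bichar m n x : ℂ).re := (Complex.continuous_re.comp hc).measurable
  have h2 : Measurable fun x => (bichar m n x : ℂ).im := (Complex.continuous_im.comp hc).measurable
  unfold halfSign
  refine Measurable.ite ?_ measurable_const measurable_const
  exact (measurableSet_lt measurable_const h1).union
    ((h1 (measurableSet_singleton 0)).inter (measurableSet_lt measurable_const h2))

lemma memLp_signFun (m n : ℤ) : MemLp (fun w => halfSign (bichar m n (coords w))) 2 lam :=
  MemLp.of_bound ((measurable_halfSign_bichar m n).comp measurable_coords).aestronglyMeasurable 1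
    (Filter.Eventually.of_forall fun _ => (abs_halfSign _).le)

/-- The function `sign cos (mα + nβ)`. -/
def signFun (m n : ℤ) : L2 := (memLp_signFun m n).toLp _

lemma signFun_coeFn (m n : ℤ) :
    signFun m n =ᵐ[lam] fun w => halfSign (bichar m n (coords w)) :=
  (memLp_signFun m n).coeFn_toLp

lemma T'_signFun_iff (m n : ℤ) (z : GG) : T' z (func (signFun m n)) = func (signFun m n) ↔
    ∀ᵐ w ∂lam, dualMult z w * halfSign (bichar m n (coords (actTorus z w))) =
      halfSign (bichar m n (coords w)) := by
  rw [T'_func_eq_iff]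
  constructor
  · intro h
    filter_upwards [h, signFun_coeFn m n, (quasiMeasurePreserving_actTorus z).ae
      (signFun_coeFn m n)] with w h1 h2 h3
    rwa [h2, h3] at h1
  · intro h
    filter_upwards [h, signFun_coeFn m n, (quasiMeasurePreserving_actTorus z).ae
      (signFun_coeFn m n)] with w h1 h2 h3
    rwa [h2, h3]

lemma T'_rot_signFun_iff {m n : ℤ} (hm : Odd m) (hn : Odd n) (u v : Circle) :
    T' (rot u, rot v) (func (signFun m n)) = func (signFun m n) ↔
    ∀ᵐ w ∂lam, halfSign (bichar m n (coords w) * (u ^ m * v ^ n)) =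
      halfSign (bichar m n (coords w)) := by
  rw [T'_signFun_iff]
  refine Filter.eventually_congr ?_
  filter_upwards [ae_isRegular_prod (rot u, rot v)] with w hw
  rw [dualMult_rot]
  rcases bichar_act_rot hm hn u v hw.1 hw.2 with ⟨a, b⟩ | ⟨a, b⟩
  · rw [a, b, one_mul]
  · rw [a, b, halfSign_neg, neg_mul_neg, one_mul]

/-- The solutions form a line, and each of the two conditions excludes only countably many values of
`t`. Avoiding zeros of the sine keeps both angles inside the affine chart. -/
lemma exists_sum_eq_not_mem_pi {m n : ℤ} (hm : m ≠ 0) (hn : n ≠ 0) (ψ : ℝ) :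
    ∃ s t : ℝ, m * s + n * t = ψ ∧ Real.sin s ≠ 0 ∧ Real.sin t ≠ 0 := by
  have hm' : (m : ℝ) ≠ 0 := by exact_mod_cast hm
  have hn' : (n : ℝ) ≠ 0 := by exact_mod_cast hn
  have hc : ((Set.range fun k : ℤ => (k : ℝ) * Real.pi) ∪
      (Set.range fun k : ℤ => (ψ - m * ((k : ℝ) * Real.pi)) / n)).Countable :=
    (Set.countable_range _).union (Set.countable_range _)
  obtain ⟨t, ht⟩ : ∃ t, t ∉ ((Set.range fun k : ℤ => (k : ℝ) * Real.pi) ∪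
      (Set.range fun k : ℤ => (ψ - m * ((k : ℝ) * Real.pi)) / n)) := by
    by_contra! h
    exact Cardinal.not_countable_real (hc.mono fun t _ => h t)
  refine ⟨(ψ - n * t) / m, t, by field_simp; ring, ?_, ?_⟩
  · intro h
    obtain ⟨k, hk⟩ := Real.sin_eq_zero_iff.1 h
    refine ht (Or.inr ⟨k, ?_⟩)
    simp only [hk]
    field_simp
    ring
  · intro h
    obtain ⟨k, hk⟩ := Real.sin_eq_zero_iff.1 h
    exact ht (Or.inl ⟨k, hk⟩)

lemma exists_bichar_eq {m n : ℤ} (hm : m ≠ 0) (hn : n ≠ 0) (c : Circle) :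
    ∃ x, bichar m n x = c ∨ bichar m n x = -c := by
  obtain ⟨ψ, rfl⟩ := Circle.exp_surjective c
  obtain ⟨s, t, h, hs, ht⟩ := exists_sum_eq_not_mem_pi hm hn ψ
  have him : ∀ s, ((Circle.exp s : Circle) : ℂ).im = Real.sin s := fun s => by
    rw [Circle.coe_exp, Complex.exp_ofReal_mul_I_im]
  obtain ⟨x, hx⟩ := cay_cot (u := Circle.exp s) (by rwa [him])
  obtain ⟨y, hy⟩ := cay_cot (u := Circle.exp t) (by rwa [him])
  have hz : ∀ (k : ℤ) (a b : Circle), a = b ∨ a = -b → a ^ k = b ^ k ∨ a ^ k = -b ^ k := by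
    rintro k a b (rfl | rfl)
    · exact Or.inl rfl
    · rcases Int.even_or_odd k with hk | hk
      · exact Or.inl (hk.neg_zpow b)
      · exact Or.inr (hk.neg_zpow b)
  refine ⟨(x, y), ?_⟩
  rw [← h, Circle.exp_add, Circle.exp_intCast_mul, Circle.exp_intCast_mul, bichar]
  rcases hz m _ _ hx with h1 | h1 <;> rcases hz n _ _ hy with h2 | h2 <;> simp [h1, h2]

/-- Where `Re(χc)` and `Re χ` have opposite signs the hypothesis fails. This set is open and null,
hence empty, so the product of real parts is nonnegative everywhere. A well-chosen phase then forces
`c = 1`. -/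
lemma eq_one_of_halfSign_mul {m n : ℤ} (hm : m ≠ 0) (hn : n ≠ 0) (c : Circle)
    (h : ∀ᵐ w ∂lam, halfSign (bichar m n (coords w) * c) = halfSign (bichar m n (coords w))) :
    c = 1 := by
  have h' := ae_coord_of_ae h
  simp only [coords, coord_ofCoord, Prod.mk.eta] at h'
  have hc : Continuous fun x => (bichar m n x : ℂ) :=
    continuous_subtype_val.comp (continuous_bichar m n)
  have hpos : ∀ x, 0 ≤ ((bichar m n x * c : Circle) : ℂ).re * (bichar m n x : ℂ).re := by
    have ho : IsOpen {x | ((bichar m n x * c : Circle) : ℂ).re * (bichar m n x : ℂ).re < 0} := by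
      refine isOpen_lt ?_ continuous_const
      simp only [Circle.coe_mul]
      exact (Complex.continuous_re.comp (hc.mul continuous_const)).mul
        (Complex.continuous_re.comp hc)
    have h0 : (volume : Measure (ℝ × ℝ))
        {x | ((bichar m n x * c : Circle) : ℂ).re * (bichar m n x : ℂ).re < 0} = 0 := by
      refine measure_mono_null ?_ (mem_ae_iff.1 h')
      intro x hx hx'
      exact halfSign_ne_of_re_mul_neg hx hx'
    rw [IsOpen.measure_eq_zero_iff volume ho] at h0
    intro x
    by_contra! hx
    exact (Set.eq_empty_iff_forall_notMem.1 h0 x) hx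
  obtain ⟨γ, rfl⟩ := Circle.exp_surjective c
  -- The phase `(π - γ)/2` is the one that translation by `γ` reflects in `π/2`, so the product of
  -- real parts is `-cos²`. The possible sign in `exists_bichar_eq` disappears in the product.
  obtain ⟨x, hx⟩ := exists_bichar_eq hm hn (Circle.exp ((Real.pi - γ) / 2))
  have hx2 : 0 ≤ ((Circle.exp ((Real.pi - γ) / 2) * Circle.exp γ : Circle) : ℂ).re *
      (Circle.exp ((Real.pi - γ) / 2) : ℂ).re := by
    have := hpos x
    rcases hx with hx | hx
    · rwa [hx] at this
    · rw [hx, neg_mul, Circle.coe_neg, Circle.coe_neg, Complex.neg_re, Complex.neg_re,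
        neg_mul_neg] at this
      exact this
  have hre : ∀ s, ((Circle.exp s : Circle) : ℂ).re = Real.cos s := fun s => by
    rw [Circle.coe_exp, Complex.exp_ofReal_mul_I_re]
  rw [← Circle.exp_add, hre, hre] at hx2
  have e : Real.cos ((Real.pi - γ) / 2 + γ) = -Real.cos ((Real.pi - γ) / 2) := by
    rw [← Real.cos_pi_sub]
    congr 1
    ring
  rw [e] at hx2
  have h0 : Real.cos ((Real.pi - γ) / 2) = 0 := by nlinarith
  obtain ⟨k, hk⟩ := Real.cos_eq_zero_iff.1 h0
  rw [Circle.exp_eq_one]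
  refine ⟨-k, ?_⟩
  push_cast
  linarith

/-- Constancy of `k` is an identity between quadratic polynomials in `x`. Its values at `0, 1, -1`
give equal row norms and orthogonal rows. -/
lemma exists_rot_of_kFactor_eq {g : SL(2, ℝ)} {c : ℝ} (h : ∀ x, kFactor g x = c) :
    ∃ u, g = rot u := by
  have h' : ∀ x : ℝ, (x * g 0 1 + g 1 1) ^ 2 + (x * g 0 0 + g 1 0) ^ 2 = c ^ 2 * (1 + x ^ 2) := by
    intro x
    rw [← h x, kFactor_sq, div_mul_cancel₀]
    positivity
  have h0 := h' 0
  have h1 := h' 1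
  have h2 := h' (-1)
  exact exists_rot_eq_of_row_norms g (C := c ^ 2) (by linarith) (by linarith) (by linarith)

/-- The sign function has absolute value 1, so taking absolute values in the invariance equation
leaves `(k_g k_h)⁻³ = 1`. By continuity this holds at all points of the chart, and fixing one
variable makes each factor constant. -/
lemma exists_rot_of_T'_signFun {m n : ℤ} {z : GG}
    (h : T' z (func (signFun m n)) = func (signFun m n)) :
    ∃ u v, z = (rot u, rot v) := by
  rw [T'_signFun_iff] at h
  have h1 : ∀ᵐ w ∂lam, kFactor z.1 (coord w.1) * kFactor z.2 (coord w.2) = 1 := by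
    filter_upwards [h, ae_isRegular_prod z] with w h1 h2
    have h3 := congrArg abs h1
    have hs : ∀ {g : SL(2, ℝ)} {P : P1}, IsRegular g P → |sFactor g (coord P)| = 1 :=
      fun {g P} hP => by
        have := congrArg abs (sFactor_mul_self g hP.2)
        rw [abs_mul, abs_one] at this
        nlinarith [abs_nonneg (sFactor g (coord P))]
    have hk1 := kFactor_pos z.1 (coord w.1)
    have hk2 := kFactor_pos z.2 (coord w.2)
    rw [abs_mul, abs_halfSign, abs_halfSign, mul_one, dualMult, dualFactor, dualFactor, abs_mul,
      abs_mul, abs_mul, hs h2.1, hs h2.2, one_mul, one_mul, ← abs_mul, ← mul_inv, ← mul_pow,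
      abs_of_pos (by positivity), inv_eq_one] at h3
    exact (pow_eq_one_iff_of_nonneg (by positivity) (by norm_num)).1 h3
  have h2 := ae_coord_of_ae h1
  simp only [coord_ofCoord] at h2
  have h3 : (fun x : ℝ × ℝ => kFactor z.1 x.1 * kFactor z.2 x.2) = fun _ => 1 :=
    (Continuous.ae_eq_iff_eq volume
      (((continuous_kFactor _).comp continuous_fst).mul ((continuous_kFactor _).comp continuous_snd))
      continuous_const).1 h2
  have h4 : ∀ x y, kFactor z.1 x * kFactor z.2 y = 1 := fun x y => congrFun h3 (x, y)
  obtain ⟨u, hu⟩ := exists_rot_of_kFactor_eq (g := z.1) (c := (kFactor z.2 0)⁻¹)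
    fun x => eq_inv_of_mul_eq_one_left (h4 x 0)
  obtain ⟨v, hv⟩ := exists_rot_of_kFactor_eq (g := z.2) (c := (kFactor z.1 0)⁻¹)
    fun x => eq_inv_of_mul_eq_one_right (h4 0 x)
  exact ⟨u, v, Prod.ext hu hv⟩

theorem littleGroup_signFun {m n : ℤ} (hm : Odd m) (hn : Odd n) :
    littleGroup (func (signFun m n)) = {z | ∃ u v, z = (rot u, rot v) ∧ u ^ m * v ^ n = 1} := by
  have hm0 : m ≠ 0 := by rintro rfl; simp at hm
  have hn0 : n ≠ 0 := by rintro rfl; simp at hn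
  ext z
  constructor
  · intro h
    obtain ⟨u, v, rfl⟩ := exists_rot_of_T'_signFun h
    exact ⟨u, v, rfl, eq_one_of_halfSign_mul hm0 hn0 _ ((T'_rot_signFun_iff hm hn u v).1 h)⟩
  · rintro ⟨u, v, rfl, h⟩
    refine (T'_rot_signFun_iff hm hn u v).2 (Filter.Eventually.of_forall fun w => ?_)
    rw [h, mul_one]

lemma lam_ne_zero : lam ≠ 0 := by
  intro h
  have h1 : lam1 Set.univ * lam1 Set.univ = 0 := by
    rw [← Measure.prod_prod, Set.univ_prod_univ, ← lam, h]
    simp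
  have h2 : lam1 Set.univ = ENNReal.ofReal Real.pi := by
    rw [lam1, Measure.map_apply measurable_ofAngle MeasurableSet.univ]
    simp
  rw [h2] at h1
  simp [Real.pi_pos.not_ge] at h1

lemma func_signFun_ne_zero (m n : ℤ) : func (signFun m n) ≠ 0 := by
  intro h
  have h0 : signFun m n = 0 := by
    rw [func] at h
    exact (InnerProductSpace.toDual ℝ L2).map_eq_zero_iff.1 h
  have h1 := signFun_coeFn m n
  rw [h0] at h1
  have h2 : ∀ᵐ w ∂lam, False := by
    filter_upwards [h1, Lp.coeFn_zero ℝ 2 lam] with w h1 h2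
    rw [h2] at h1
    have := abs_halfSign (bichar m n (coords w))
    rw [← h1] at this
    simp at this
  rw [Filter.eventually_false_iff_eq_bot, ae_eq_bot] at h2
  exact lam_ne_zero h2

/-! ### The groups `H(N, q, p)` -/

/-- The order of the cyclic factor of `H(N, q, p)`. -/
abbrev cycOrder (N : ℕ) (q : ℤ) : ℕ := N / N.gcd q.natAbs

lemma cycOrder_mul (N : ℕ) (q : ℤ) : cycOrder N q * N.gcd q.natAbs = N :=
  Nat.div_mul_cancel (Nat.gcd_dvd_left _ _)

/-- `Q` is `q / gcd(N, q)`, so `Q / cycOrder N q` is `q / N` in lowest terms. -/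
lemma exists_cofactor {N : ℕ} (hN : N ≠ 0) (q : ℤ) :
    ∃ Q : ℤ, q * cycOrder N q = Q * N ∧ IsCoprime (cycOrder N q : ℤ) Q := by
  have hg : 0 < N.gcd q.natAbs := Nat.gcd_pos_of_pos_left _ (Nat.pos_of_ne_zero hN)
  obtain ⟨Q, hQ⟩ : ((N.gcd q.natAbs : ℕ) : ℤ) ∣ q :=
    Int.natCast_dvd.2 (Nat.gcd_dvd_right _ _)
  have hN' : ((cycOrder N q : ℕ) : ℤ) * (N.gcd q.natAbs : ℕ) = N := by
    exact_mod_cast cycOrder_mul N q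
  refine ⟨Q, ?_, ?_⟩
  · linear_combination (cycOrder N q : ℤ) * hQ + Q * hN'
  · rw [Int.isCoprime_iff_gcd_eq_one, Int.gcd, Int.natAbs_natCast]
    have h1 : Q.natAbs = q.natAbs / N.gcd q.natAbs := by
      have h2 := congrArg Int.natAbs hQ
      rw [Int.natAbs_mul, Int.natAbs_natCast] at h2
      exact (Nat.div_eq_of_eq_mul_right hg h2).symm
    rw [h1]
    exact Nat.coprime_div_gcd_div_gcd hg

/-- On an element of `H` the phase is `2πQi`, with `Q` the cofactor of `q`. Conversely, a phase
`2πk` is realized by using Bézout to split `k` between a change of lift of the first angle and a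
choice of the index `i`. -/
lemma rot_mem_H_iff {N : ℕ} (hN : N ≠ 0) {q p : ℤ} (hq : q ≠ 0) (hqp : IsCoprime q p)
    (x y : Circle) : (rot x, rot y) ∈ H N q p ↔
      x ^ (-(p * cycOrder N q)) * y ^ (q * cycOrder N q) = 1 := by
  obtain ⟨Q, hQ, hcop⟩ := exists_cofactor hN q
  have hNR : (N : ℝ) ≠ 0 := by exact_mod_cast hN
  have hqR : (q : ℝ) ≠ 0 := by exact_mod_cast hq
  have hQR : (q : ℝ) * (cycOrder N q : ℕ) = (Q : ℝ) * N := by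
    simpa only [Int.cast_mul, Int.cast_natCast] using congrArg (Int.cast : ℤ → ℝ) hQ
  have hM : ((cycOrder N q : ℕ) : ℝ) ≠ 0 := by
    intro h
    have h' : cycOrder N q = 0 := by exact_mod_cast h
    have := cycOrder_mul N q
    rw [h', zero_mul] at this
    exact hN this.symm
  set M := cycOrder N q
  constructor
  · rintro ⟨θ, i, h⟩
    rw [R_eq_rot, R_eq_rot, Prod.mk.injEq] at h
    rw [rot_injective h.1, rot_injective h.2, ← Circle.exp_intCast_mul, ← Circle.exp_intCast_mul,
      ← Circle.exp_add, Circle.exp_eq_one]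
    refine ⟨Q * i, ?_⟩
    push_cast
    have : (q : ℝ) * M / N = Q := by rw [hQR]; field_simp
    rw [← this]
    ring
  · intro h
    obtain ⟨θ, rfl⟩ := Circle.exp_surjective x
    obtain ⟨η, rfl⟩ := Circle.exp_surjective y
    rw [← Circle.exp_intCast_mul, ← Circle.exp_intCast_mul, ← Circle.exp_add,
      Circle.exp_eq_one] at h
    obtain ⟨k, hk⟩ := h
    have hQq : Q ∣ q * M := ⟨N, hQ⟩
    have hpQ : IsCoprime (M * p : ℤ) Q := by
      have hQq' : Q ∣ q := hcop.symm.dvd_of_dvd_mul_right hQq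
      exact hcop.mul_left (hqp.of_isCoprime_of_dvd_left hQq').symm
    obtain ⟨s, t, hst⟩ := hpQ
    -- The first angle matters only modulo `2π`. Shifting it by `2πsk` and taking `i = kt` works
    -- because `k = k(sMp + tQ)`.
    refine ⟨(θ + 2 * Real.pi * ((s * k : ℤ) : ℝ)) / q, k * t, ?_⟩
    rw [R_eq_rot, R_eq_rot]
    have e1 : (q : ℝ) * ((θ + 2 * Real.pi * ((s * k : ℤ) : ℝ)) / q) =
        θ + ((s * k : ℤ) : ℝ) * (2 * Real.pi) := by
      field_simp
    have hstR : (s : ℝ) * (M * p) + t * Q = 1 := by exact_mod_cast hst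
    have hMN : (M : ℝ) * q / N = Q := by rw [mul_comm, hQR]; field_simp
    have e2 : (p : ℝ) * ((θ + 2 * Real.pi * ((s * k : ℤ) : ℝ)) / q) +
        2 * Real.pi / N * ((k * t : ℤ) : ℝ) = η := by
      have h3 : (M : ℝ) * q * ((p : ℝ) * ((θ + 2 * Real.pi * ((s * k : ℤ) : ℝ)) / q) +
        2 * Real.pi / N * ((k * t : ℤ) : ℝ)) = M * q * η := by
        calc _ = M * (p : ℝ) * (θ + 2 * Real.pi * ((s * k : ℤ) : ℝ)) +
              2 * Real.pi * ((k * t : ℤ) : ℝ) * ((M : ℝ) * q / N) := by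
              field_simp
          _ = _ := by
              rw [hMN]
              push_cast at hk ⊢
              linear_combination 2 * Real.pi * k * hstR - hk
      exact mul_left_cancel₀ (mul_ne_zero hM hqR) h3
    rw [e1, e2, Circle.exp_add, Circle.exp_int_mul_two_pi, mul_one]

lemma H_subset_range_rot {N : ℕ} {q p : ℤ} {z : GG} (hz : z ∈ H N q p) :
    ∃ x y, z = (rot x, rot y) := by
  obtain ⟨θ, i, rfl⟩ := hz
  exact ⟨_, _, by rw [R_eq_rot, R_eq_rot]⟩

lemma coe_H_eq {N : ℕ} (hN : N ≠ 0) {q p : ℤ} (hq : q ≠ 0) (hqp : IsCoprime q p) :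
    (H N q p : Set GG) = {z | ∃ u v, z = (rot u, rot v) ∧
      u ^ (-(p * cycOrder N q)) * v ^ (q * cycOrder N q) = 1} := by
  ext z
  constructor
  · intro hz
    obtain ⟨x, y, rfl⟩ := H_subset_range_rot hz
    exact ⟨x, y, rfl, (rot_mem_H_iff hN hq hqp x y).1 hz⟩
  · rintro ⟨x, y, rfl, h⟩
    exact (rot_mem_H_iff hN hq hqp x y).2 h

/-- The homomorphism `(j, z) ↦ (χ(j)ᵃ z^q, χ(j)ᵇ z^p)` to the torus. -/
def torusHom (M : ℕ) [NeZero M] (a b q p : ℤ) :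
    Multiplicative (ZMod M) × Circle →* GG :=
  MonoidHom.mk' (fun w => (rot (ZMod.toCircle w.1.toAdd ^ a * w.2 ^ q),
    rot (ZMod.toCircle w.1.toAdd ^ b * w.2 ^ p))) fun w w' => by
    simp only [Prod.mk_mul_mk, ← map_mul, Prod.fst_mul, Prod.snd_mul, toAdd_mul,
      AddChar.map_add_eq_mul, mul_zpow]
    rw [mul_mul_mul_comm, mul_mul_mul_comm (ZMod.toCircle w.1.toAdd ^ b)]

lemma torusHom_apply (M : ℕ) [NeZero M] (a b q p : ℤ) (w : Multiplicative (ZMod M) × Circle) :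
    torusHom M a b q p w = (rot (ZMod.toCircle w.1.toAdd ^ a * w.2 ^ q),
    rot (ZMod.toCircle w.1.toAdd ^ b * w.2 ^ p)) := rfl

lemma continuous_torusHom (M : ℕ) [NeZero M] (a b q p : ℤ) : Continuous (torusHom M a b q p) := by
  have h1 : Continuous fun w : Multiplicative (ZMod M) × Circle => ZMod.toCircle w.1.toAdd :=
    (continuous_of_discreteTopology (f := fun j : Multiplicative (ZMod M) =>
      ZMod.toCircle j.toAdd)).comp continuous_fst
  exact (continuous_rot.comp ((h1.zpow a).mul (continuous_snd.zpow q))).prodMk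
    (continuous_rot.comp ((h1.zpow b).mul (continuous_snd.zpow p)))

lemma torus_zpow_combine (χ z : Circle) (a b q p s t : ℤ) :
    (χ ^ a * z ^ q) ^ s * (χ ^ b * z ^ p) ^ t = χ ^ (a * s + b * t) * z ^ (q * s + p * t) := by
  rw [mul_zpow, mul_zpow, mul_mul_mul_comm, ← _root_.zpow_mul, ← _root_.zpow_mul,
    ← _root_.zpow_mul, ← _root_.zpow_mul,
    ← _root_.zpow_add, ← _root_.zpow_add]

/-- The exponent matrix has determinant 1, and the two combinations apply the rows of its integer
inverse. -/
lemma torusHom_injective (M : ℕ) [NeZero M] {a b q p : ℤ} (h : q * b - p * a = 1) :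
    Function.Injective (torusHom M a b q p) := by
  rw [injective_iff_map_eq_one]
  rintro ⟨j, z⟩ hj
  rw [torusHom_apply, Prod.mk_eq_one, map_eq_one_iff _ rot_injective,
    map_eq_one_iff _ rot_injective] at hj
  obtain ⟨h1, h2⟩ := hj
  dsimp only at h1 h2
  have e1 := torus_zpow_combine (ZMod.toCircle j.toAdd) z a b q p (-p) q
  have e2 := torus_zpow_combine (ZMod.toCircle j.toAdd) z a b q p b (-a)
  rw [h1, h2, _root_.one_zpow, _root_.one_zpow, one_mul, show a * -p + b * q = 1 by linarith,
    show q * -p + p * q = 0 by ring, _root_.zpow_one, _root_.zpow_zero, mul_one] at e1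
  rw [h1, h2, _root_.one_zpow, _root_.one_zpow, one_mul, show q * b + p * -a = 1 by linarith,
    show a * b + b * -a = 0 by ring, _root_.zpow_one, _root_.zpow_zero, one_mul] at e2
  have hj : j.toAdd = 0 := ZMod.injective_toCircle (by rw [← e1, AddChar.map_zero_eq_one])
  exact Prod.ext (Multiplicative.toAdd.injective hj) e2.symm

lemma exists_toCircle_eq {M : ℕ} [NeZero M] {c : Circle} (hc : c ^ M = 1) :
    ∃ j : ZMod M, ZMod.toCircle j = c := by
  obtain ⟨j, hj⟩ := (bijective_rootsOfUnityAddChar M).2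
    ⟨toUnits c, by rw [mem_rootsOfUnity, ← map_pow, hc, map_one]⟩
  refine ⟨j, ?_⟩
  rw [← ZMod.rootsOfUnityAddChar_val, hj]
  rfl

/-- In the coordinates given by the inverse matrix, `x^(-p) y^q` is the first coordinate. The
equation of `H` says precisely that it is a root of unity of order dividing `cycOrder N q`, and the
second coordinate is free. -/
lemma range_torusHom {N : ℕ} (hN : N ≠ 0) {a b q p : ℤ} [NeZero (cycOrder N q)]
    (hq : q ≠ 0) (h : q * b - p * a = 1) :
    (torusHom (cycOrder N q) a b q p).range = H N q p := by
  have hqp : IsCoprime q p := ⟨b, -a, by linarith⟩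
  refine le_antisymm ?_ ?_
  · rintro _ ⟨⟨j, z⟩, rfl⟩
    rw [torusHom_apply, rot_mem_H_iff hN hq hqp]
    simp only
    rw [torus_zpow_combine, show a * -(p * (cycOrder N q : ℕ)) + b * (q * (cycOrder N q : ℕ)) =
      (cycOrder N q : ℕ) by linear_combination (cycOrder N q : ℤ) * h,
      show q * -(p * (cycOrder N q : ℕ)) + p * (q * (cycOrder N q : ℕ)) = 0 by ring,
      _root_.zpow_zero,
      mul_one, _root_.zpow_natCast, ← AddChar.map_nsmul_eq_pow]
    simp
  · intro w hw
    obtain ⟨x, y, rfl⟩ := H_subset_range_rot hw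
    rw [rot_mem_H_iff hN hq hqp] at hw
    obtain ⟨j, hj⟩ := exists_toCircle_eq (M := cycOrder N q) (c := x ^ (-p) * y ^ q) (by
      rw [← hw, ← _root_.zpow_natCast, mul_zpow, ← _root_.zpow_mul, ← _root_.zpow_mul, neg_mul])
    refine ⟨(Multiplicative.ofAdd j, x ^ b * y ^ (-a)), ?_⟩
    rw [torusHom_apply]
    simp only [toAdd_ofAdd, hj]
    rw [torus_zpow_combine, torus_zpow_combine, show -p * a + b * q = 1 by linarith,
      show q * a + -a * q = 0 by ring, show -p * b + b * p = 0 by ring,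
      show q * b + -a * p = 1 by linarith]
    simp

theorem nonempty_H_equiv {N : ℕ} (hN : N ≠ 0) {q p : ℤ} (hq : q ≠ 0) (hqp : IsCoprime q p) :
    Nonempty (H N q p ≃ₜ* Multiplicative (ZMod (cycOrder N q)) × Circle) := by
  obtain ⟨b, a, hab⟩ := hqp
  have : NeZero (cycOrder N q) := ⟨fun h => hN (by
    have := cycOrder_mul N q
    rw [h, zero_mul] at this
    exact this.symm)⟩
  have h : q * b - p * (-a) = 1 := by linarith
  have hr := range_torusHom hN (a := -a) hq h
  have hmem : ∀ w, torusHom (cycOrder N q) (-a) b q p w ∈ H N q p := fun w => by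
    rw [← hr]
    exact ⟨w, rfl⟩
  let e : Multiplicative (ZMod (cycOrder N q)) × Circle ≃* H N q p :=
    MulEquiv.ofBijective ((torusHom (cycOrder N q) (-a) b q p).codRestrict (H N q p) hmem)
      ⟨fun w w' hw => torusHom_injective (cycOrder N q) h (congrArg Subtype.val hw), fun z => by
        obtain ⟨w, hw⟩ := hr.ge z.2
        exact ⟨w, Subtype.ext hw⟩⟩
  have hc : Continuous e := (continuous_torusHom _ _ _ _ _).subtype_mk hmem
  let E : Multiplicative (ZMod (cycOrder N q)) × Circle ≃ₜ H N q p :=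
    Continuous.homeoOfEquivCompactToT2 (f := e.toEquiv) hc
  exact ⟨(ContinuousMulEquiv.mk e hc E.symm.continuous).symm⟩

lemma isClosed_H {N : ℕ} (hN : N ≠ 0) {q p : ℤ} (hq : q ≠ 0) (hqp : IsCoprime q p) :
    IsClosed (H N q p : Set GG) := by
  obtain ⟨e⟩ := nonempty_H_equiv hN hq hqp
  have : NeZero (cycOrder N q) := ⟨fun h => hN (by
    have := cycOrder_mul N q
    rw [h, zero_mul] at this
    exact this.symm)⟩
  have : CompactSpace (H N q p) := e.symm.toHomeomorph.compactSpace
  exact (isCompact_iff_compactSpace.2 this).isClosed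

lemma infinite_H {N : ℕ} (hN : N ≠ 0) {q p : ℤ} (hq : q ≠ 0) (hqp : IsCoprime q p) :
    (H N q p : Set GG).Infinite := by
  obtain ⟨e⟩ := nonempty_H_equiv hN hq hqp
  have : Infinite Circle := by
    -- Distinct natural numbers are distinct modulo `2π`, since `π` is irrational.
    refine Infinite.of_injective (fun k : ℕ => Circle.exp k) fun k l h => ?_
    by_contra hne
    obtain ⟨m, hm⟩ := Circle.exp_eq_exp.1 h
    have hm0 : m ≠ 0 := by
      rintro rfl
      exact hne (by simpa using hm)
    refine irrational_pi ⟨((k : ℚ) - l) / (2 * m), ?_⟩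
    have : (m : ℝ) ≠ 0 := by exact_mod_cast hm0
    push_cast
    rw [hm]
    field_simp
    ring
  have : Infinite (H N q p) := Infinite.of_injective _ e.symm.injective
  exact Set.infinite_coe_iff.1 this

/-! ### Completeness of the odd characters -/

/-- Trigonometric polynomials are dense in `L²` of any finite measure on the torus, so the measure
need not be identified with Haar measure. -/
lemma ae_eq_zero_of_integral_mFourier_mul_eq_zero {d : Type*} [Fintype d]
    (ν : Measure (UnitAddTorus d)) [IsFiniteMeasure ν] {G : UnitAddTorus d → ℂ} (hG : MemLp G 2 ν)
    (h : ∀ k : d → ℤ, ∫ t, UnitAddTorus.mFourier k t * G t ∂ν = 0) : G =ᵐ[ν] 0 := by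
  have htop := (ContinuousMap.toLp_denseRange ℂ ν ℂ
    (p := 2) (by norm_num)).topologicalClosure_map_submodule
    (UnitAddTorus.span_mFourier_closure_eq_top (d := d))
  rw [Submodule.map_span, Submodule.topologicalClosure_eq_top_iff] at htop
  have hmem : hG.toLp G ∈ (Submodule.span ℂ
      ((ContinuousMap.toLp 2 ν ℂ : C(UnitAddTorus d, ℂ) →L[ℂ] Lp ℂ 2 ν) ''
      Set.range (UnitAddTorus.mFourier (d := d))))ᗮ := by
    rw [Submodule.mem_orthogonal]
    intro u hu
    induction hu using Submodule.span_induction with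
    | mem u hu =>
      obtain ⟨_, ⟨k, rfl⟩, rfl⟩ := hu
      rw [MeasureTheory.L2.inner_def, ← h (-k)]
      refine integral_congr_ae ?_
      filter_upwards [hG.coeFn_toLp, ContinuousMap.coeFn_toLp (p := 2) (𝕜 := ℂ) ν
        (UnitAddTorus.mFourier k)] with t h1 h2
      have h2' : ((ContinuousMap.toLp 2 ν ℂ : C(UnitAddTorus d, ℂ) →L[ℂ] Lp ℂ 2 ν)
        (UnitAddTorus.mFourier k)) t = UnitAddTorus.mFourier k t := h2
      rw [h1, UnitAddTorus.mFourier_neg, RCLike.inner_apply, mul_comm]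
      exact congrArg (fun z => (starRingEnd ℂ) z * G t) h2'
    | zero => simp
    | add u v _ _ hu hv => rw [inner_add_left, hu, hv, add_zero]
    | smul c u _ hu => rw [inner_smul_left, hu, mul_zero]
  have hz : hG.toLp G = 0 := by
    have := htop.le hmem
    simpa using this
  have h1 := hG.coeFn_toLp
  rw [hz] at h1
  exact h1.symm.trans (Lp.coeFn_zero _ _ _)

/-- The measure `dα` on the angles `0 < α ≤ π`. -/
abbrev angleMeasure : Measure ℝ := volume.restrict (Set.Ioc 0 Real.pi)

/-- The point of the torus with two given angles. -/
def ofAngles : ℝ × ℝ → P1 × P1 := Prod.map ofAngle ofAngle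

lemma measurable_ofAngles : Measurable ofAngles := measurable_ofAngle.prodMap measurable_ofAngle

lemma lam_eq_map_ofAngles : lam = Measure.map ofAngles (angleMeasure.prod angleMeasure) := by
  rw [lam, lam1, Measure.map_prod_map _ _ measurable_ofAngle measurable_ofAngle]
  rfl

lemma measurePreserving_ofAngles :
    MeasurePreserving ofAngles (angleMeasure.prod angleMeasure) lam :=
  ⟨measurable_ofAngles, lam_eq_map_ofAngles.symm⟩

lemma integral_ofAngles {F : P1 × P1 → ℂ} (hF : AEStronglyMeasurable F lam) :
    ∫ p, F (ofAngles p) ∂angleMeasure.prod angleMeasure = ∫ w, F w ∂lam := by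
  rw [lam_eq_map_ofAngles] at hF ⊢
  rw [integral_map measurable_ofAngles.aemeasurable hF]

lemma ae_lam_iff {s : Set (P1 × P1)} (hs : MeasurableSet s) :
    (∀ᵐ w ∂lam, w ∈ s) ↔ ∀ᵐ p ∂angleMeasure.prod angleMeasure, ofAngles p ∈ s := by
  rw [lam_eq_map_ofAngles]
  exact ae_map_iff measurable_ofAngles.aemeasurable hs

/-- Discards the endpoint `π`, which is the point at infinity, where `coord` has only a default
value. -/
lemma ae_angle : ∀ᵐ p ∂angleMeasure.prod angleMeasure,
    (0 < p.1 ∧ p.1 < Real.pi) ∧ (0 < p.2 ∧ p.2 < Real.pi) := by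
  have h : ∀ᵐ s ∂angleMeasure, 0 < s ∧ s < Real.pi := by
    rw [angleMeasure, ← restrict_Ioo_eq_restrict_Ioc]
    exact ae_restrict_mem measurableSet_Ioo
  filter_upwards [Measure.quasiMeasurePreserving_fst.ae h,
    Measure.quasiMeasurePreserving_snd.ae h] with p h1 h2 using ⟨h1, h2⟩

lemma cay_coord_ofAngle {s : ℝ} (h0 : 0 < s) (h1 : s < Real.pi) :
    cay (coord (ofAngle s)) = Circle.exp s := by
  have hs := Real.sin_pos_of_pos_of_lt_pi h0 h1
  have hc : coord (ofAngle s) = Real.cos s / Real.sin s := by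
    change (![Real.cos s, Real.sin s] : Fin 2 → ℝ) 0 / (![Real.cos s, Real.sin s] : Fin 2 → ℝ) 1 = _
    simp
  refine cay_of_eq_mul (inv_pos.2 hs) ?_
  rw [hc, Circle.coe_exp]
  apply Complex.ext
  · rw [Complex.re_ofReal_mul, Complex.exp_ofReal_mul_I_re, Complex.add_re, Complex.ofReal_re,
      Complex.I_re]
    ring
  · rw [Complex.im_ofReal_mul, Complex.exp_ofReal_mul_I_im, Complex.add_im, Complex.ofReal_im,
      Complex.I_im, inv_mul_cancel₀ hs.ne', zero_add]

lemma bichar_ofAngles {p : ℝ × ℝ} (m n : ℤ) (h1 : 0 < p.1 ∧ p.1 < Real.pi)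
    (h2 : 0 < p.2 ∧ p.2 < Real.pi) :
    bichar m n (coords (ofAngles p)) = Circle.exp p.1 ^ m * Circle.exp p.2 ^ n := by
  rw [bichar, coords, ofAngles, Prod.map]
  simp only [cay_coord_ofAngle h1.1 h1.2, cay_coord_ofAngle h2.1 h2.2]

/-- The map from pairs of angles to the torus `(ℝ / ℤ)²`. -/
def toUnitTorus (p : ℝ × ℝ) : UnitAddTorus (Fin 2) :=
  ![((p.1 / Real.pi : ℝ) : UnitAddCircle), ((p.2 / Real.pi : ℝ) : UnitAddCircle)]

/-- The inverse of `toUnitTorus`, with values in `(0, π]²`. -/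
def ofUnitTorus (t : UnitAddTorus (Fin 2)) : ℝ × ℝ :=
  (Real.pi * (AddCircle.measurableEquivIoc 1 0 (t 0) : ℝ),
    Real.pi * (AddCircle.measurableEquivIoc 1 0 (t 1) : ℝ))

lemma measurable_toUnitTorus : Measurable toUnitTorus := by
  refine measurable_pi_iff.2 fun i => ?_
  have hm : Measurable fun s : ℝ => ((s / Real.pi : ℝ) : UnitAddCircle) :=
    AddCircle.measurable_mk'.comp (measurable_id.div_const _)
  fin_cases i
  · exact hm.comp measurable_fst
  · exact hm.comp measurable_snd

lemma measurable_ofUnitTorus : Measurable ofUnitTorus := by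
  have hm : ∀ i : Fin 2, Measurable fun t : UnitAddTorus (Fin 2) =>
      Real.pi * (AddCircle.measurableEquivIoc 1 0 (t i) : ℝ) := fun i =>
    (measurable_subtype_coe.comp ((AddCircle.measurableEquivIoc 1 0).measurable.comp
      (measurable_pi_apply i))).const_mul _
  exact (hm 0).prodMk (hm 1)

lemma ofUnitTorus_toUnitTorus {p : ℝ × ℝ} (h1 : 0 < p.1 ∧ p.1 < Real.pi)
    (h2 : 0 < p.2 ∧ p.2 < Real.pi) : ofUnitTorus (toUnitTorus p) = p := by
  have key : ∀ s : ℝ, 0 < s ∧ s < Real.pi →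
      Real.pi * (AddCircle.measurableEquivIoc 1 0 ((s / Real.pi : ℝ) : UnitAddCircle) : ℝ) = s := by
    rintro s ⟨h0, h1⟩
    have hmem : s / Real.pi ∈ Set.Ioc (0 : ℝ) (0 + 1) :=
      ⟨div_pos h0 Real.pi_pos, by rw [zero_add]; exact ((div_lt_one Real.pi_pos).2 h1).le⟩
    have : AddCircle.measurableEquivIoc 1 0 ((s / Real.pi : ℝ) : UnitAddCircle) =
        ⟨s / Real.pi, hmem⟩ :=
      Subtype.ext (AddCircle.equivIoc_coe_of_mem hmem)
    rw [this]
    field_simp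
  exact Prod.ext (key _ h1) (key _ h2)

lemma mFourier_toUnitTorus (k : Fin 2 → ℤ) (p : ℝ × ℝ) :
    UnitAddTorus.mFourier k (toUnitTorus p) =
      ((Circle.exp p.1 ^ (2 * k 0) * Circle.exp p.2 ^ (2 * k 1) : Circle) : ℂ) := by
  have key : ∀ (l : ℤ) (s : ℝ), fourier l ((s / Real.pi : ℝ) : UnitAddCircle) =
      ((Circle.exp s ^ (2 * l) : Circle) : ℂ) := by
    intro l s
    rw [fourier_coe_apply, ← Circle.exp_intCast_mul, Circle.coe_exp]
    congr 1
    have : (Real.pi : ℂ) ≠ 0 := by exact_mod_cast Real.pi_ne_zero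
    push_cast
    field_simp
  simp only [UnitAddTorus.mFourier, ContinuousMap.coe_mk, Fin.prod_univ_two, toUnitTorus,
    Matrix.cons_val_zero, Matrix.cons_val_one, key, Circle.coe_mul]

lemma memLp_charFun (m n : ℤ) (κ : ℂ) :
    MemLp (fun w => (κ * bichar m n (coords w)).re) 2 lam := by
  have hc : Continuous fun x => (κ * bichar m n x).re :=
    Complex.continuous_re.comp (continuous_const.mul
      (continuous_subtype_val.comp (continuous_bichar m n)))
  refine MemLp.of_bound (hc.measurable.comp measurable_coords).aestronglyMeasurable ‖κ‖
    (Filter.Eventually.of_forall fun w => ?_)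
  refine (Complex.abs_re_le_norm _).trans (le_of_eq ?_)
  rw [norm_mul, Circle.norm_coe, mul_one]

/-- The real part of a multiple of a character. -/
def charFun (m n : ℤ) (κ : ℂ) : L2 := (memLp_charFun m n κ).toLp _

lemma charFun_coeFn (m n : ℤ) (κ : ℂ) :
    charFun m n κ =ᵐ[lam] fun w => (κ * bichar m n (coords w)).re :=
  (memLp_charFun m n κ).coeFn_toLp

lemma integrable_mul_bichar (f : L2) (m n : ℤ) :
    Integrable (fun w => (f w : ℂ) * (bichar m n (coords w) : ℂ)) lam := by
  have hf : Integrable (fun w => (f w : ℂ)) lam :=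
    ((Lp.memLp f).integrable (by norm_num)).ofReal
  refine hf.mul_bdd (c := 1) ?_ (Filter.Eventually.of_forall fun w => (Circle.norm_coe _).le)
  exact ((continuous_subtype_val.comp (continuous_bichar m n)).measurable.comp
    measurable_coords).aestronglyMeasurable

lemma func_charFun (f : L2) (m n : ℤ) (κ : ℂ) :
    func f (charFun m n κ) = (κ * ∫ w, (f w : ℂ) * (bichar m n (coords w) : ℂ) ∂lam).re := by
  rw [func_apply, ← integral_const_mul, ← RCLike.re_eq_complex_re,
    ← integral_re ((integrable_mul_bichar f m n).const_mul κ)]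
  refine integral_congr_ae ?_
  filter_upwards [charFun_coeFn m n κ] with w hw
  rw [hw, RCLike.re_eq_complex_re, mul_left_comm, Complex.re_ofReal_mul]

/-- Multiplying `f` by `e^{i(α+β)}` turns the odd characters into the even ones `e^{2i(kα+lβ)}`. On
a square of side `π` these are the complete Fourier system. -/
theorem eq_zero_of_func_charFun_eq_zero (f : L2)
    (h : ∀ m n : ℤ, Odd m → Odd n → ∀ κ, func f (charFun m n κ) = 0) : f = 0 := by
  have h1 : ∀ m n : ℤ, Odd m → Odd n →
      ∫ w, (f w : ℂ) * (bichar m n (coords w) : ℂ) ∂lam = 0 := by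
    intro m n hm hn
    -- The choices `κ = 1` and `κ = i` give the real part and, up to sign, the imaginary part of the
    -- complex integral.
    have a := h m n hm hn 1
    have b := h m n hm hn Complex.I
    rw [func_charFun] at a b
    apply Complex.ext
    · simpa using a
    · simpa using b
  set μ := angleMeasure.prod angleMeasure with hμ
  have h2 : ∀ m n : ℤ, Odd m → Odd n →
      ∫ p, (f (ofAngles p) : ℂ) * ((Circle.exp p.1 ^ m * Circle.exp p.2 ^ n : Circle) : ℂ) ∂μ =
        0 := by
    intro m n hm hn
    rw [← h1 m n hm hn, ← integral_ofAngles (integrable_mul_bichar f m n).1]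
    refine integral_congr_ae ?_
    filter_upwards [ae_angle] with p hp
    rw [bichar_ofAngles m n hp.1 hp.2]
  have hexp : Continuous fun p : ℝ × ℝ => ((Circle.exp p.1 * Circle.exp p.2 : Circle) : ℂ) :=
    continuous_subtype_val.comp ((Circle.exp.continuous.comp continuous_fst).mul
      (Circle.exp.continuous.comp continuous_snd))
  have hfm : Measurable f := (Lp.stronglyMeasurable f).measurable
  set F : ℝ × ℝ → ℂ := fun p =>
    (f (ofAngles p) : ℂ) * ((Circle.exp p.1 * Circle.exp p.2 : Circle) : ℂ) with hF
  have hFm : Measurable F :=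
    (Complex.measurable_ofReal.comp (hfm.comp measurable_ofAngles)).mul hexp.measurable
  have hFLp : MemLp F 2 μ := by
    have h3 : MemLp (fun p => f (ofAngles p)) 2 μ :=
      (Lp.memLp f).comp_measurePreserving measurePreserving_ofAngles
    refine h3.of_le hFm.aestronglyMeasurable (Filter.Eventually.of_forall fun p => ?_)
    rw [hF]
    simp only [norm_mul, Circle.norm_coe, mul_one, Complex.norm_real, le_refl]
  have hGF : (fun p => F (ofUnitTorus (toUnitTorus p))) =ᵐ[μ] F := by
    filter_upwards [ae_angle] with p hp
    rw [ofUnitTorus_toUnitTorus hp.1 hp.2]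
  have hGm : Measurable fun t => F (ofUnitTorus t) := hFm.comp measurable_ofUnitTorus
  have hG0 := ae_eq_zero_of_integral_mFourier_mul_eq_zero (Measure.map toUnitTorus μ)
    (G := fun t => F (ofUnitTorus t))
    ((memLp_map_measure_iff hGm.aestronglyMeasurable measurable_toUnitTorus.aemeasurable).2
      ((memLp_congr_ae hGF).2 hFLp)) (fun k => by
      have hmG : AEStronglyMeasurable (fun t => UnitAddTorus.mFourier k t * F (ofUnitTorus t))
          (Measure.map toUnitTorus μ) :=
        ((UnitAddTorus.mFourier k).continuous.measurable.mul hGm).aestronglyMeasurable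
      rw [integral_map measurable_toUnitTorus.aemeasurable hmG]
      rw [← h2 (2 * k 0 + 1) (2 * k 1 + 1) (odd_two_mul_add_one _) (odd_two_mul_add_one _)]
      refine integral_congr_ae ?_
      filter_upwards [hGF] with p hp
      rw [hp, mFourier_toUnitTorus, hF]
      simp only [Circle.coe_mul, _root_.zpow_add, _root_.zpow_one]
      ring)
  have hF0 : ∀ᵐ p ∂μ, f (ofAngles p) = 0 := by
    filter_upwards [ae_of_ae_map measurable_toUnitTorus.aemeasurable hG0, hGF] with p a b
    rw [b] at a
    have a' : (f (ofAngles p) : ℂ) * ((Circle.exp p.1 * Circle.exp p.2 : Circle) : ℂ) = 0 := a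
    rcases mul_eq_zero.1 a' with c | c
    · exact_mod_cast c
    · exact absurd c (Circle.coe_ne_zero _)
  refine (Lp.eq_zero_iff_ae_eq_zero).2 ?_
  exact (ae_lam_iff (hfm (measurableSet_singleton 0))).2 hF0

/-- A rotation acts on the characters of bidegree `(m, n)` by multiplication. -/
lemma T_rot_charFun {m n : ℤ} (hm : Odd m) (hn : Odd n) (u v : Circle) (κ : ℂ) :
    T (rot u, rot v) (charFun m n κ) = charFun m n (κ * (u ^ m * v ^ n : Circle)) := by
  refine Lp.ext ?_
  filter_upwards [T_coeFn (rot u, rot v) (charFun m n κ),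
    charFun_coeFn m n (κ * (u ^ m * v ^ n : Circle)),
    (quasiMeasurePreserving_actTorus (rot u, rot v)).ae (charFun_coeFn m n κ),
    ae_isRegular_prod (rot u, rot v)] with w h1 h2 h3 h4
  rw [h1, h2, h3, multiplier_rot]
  rcases bichar_act_rot hm hn u v h4.1 h4.2 with ⟨a, b⟩ | ⟨a, b⟩
  · rw [a, b, one_mul, Circle.coe_mul]
    congr 1
    ring
  · rw [a, b, Circle.coe_neg, Circle.coe_mul, mul_neg, Complex.neg_re, neg_one_mul, neg_neg]
    congr 1
    ring

/-- If some element of `S` takes a value `c ≠ 1` on a character, an invariant functional vanishes on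
that character. If this happens for all odd characters, completeness makes the functional zero. -/
theorem exists_odd_characters {S : Subgroup GG} (hinv : invariants S ≠ ⊥) :
    ∃ m n : ℤ, Odd m ∧ Odd n ∧
      ∀ u v : Circle, (rot u, rot v) ∈ S → u ^ m * v ^ n = 1 := by
  obtain ⟨φ, hφ, hφ0⟩ := (Submodule.ne_bot_iff _).1 hinv
  obtain ⟨f, rfl⟩ := exists_func_eq φ
  by_contra! hcon
  refine hφ0 ?_
  rw [eq_zero_of_func_charFun_eq_zero f, func, map_zero]
  intro m n hm hn κ
  obtain ⟨u, v, huv, hc⟩ := hcon m n hm hn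
  have hc' : ((u ^ m * v ^ n : Circle) : ℂ) - 1 ≠ 0 := by
    rw [sub_ne_zero]
    exact fun h => hc (Circle.coe_eq_one.1 h)
  have hinv : ∀ α, func f (T (rot u, rot v) α) = func f α := by
    intro α
    have h1 := hφ _ (S.inv_mem huv)
    have h2 := congrArg (fun ψ : L2Dual => ψ α) h1
    simpa only [T', inv_inv, ContinuousLinearMap.comp_apply] using h2
  -- Dividing by `c - 1` makes the given character the difference between a rotated character and
  -- itself, on which an invariant functional vanishes.
  have key := hinv (charFun m n (κ / (((u ^ m * v ^ n : Circle) : ℂ) - 1)))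
  rw [T_rot_charFun hm hn, func_charFun, func_charFun, ← sub_eq_zero, ← Complex.sub_re] at key
  rw [func_charFun, ← key]
  congr 1
  field_simp

/-! ### Closed subgroups of the torus -/

/-- The pairs of angles of the elements of `S`. -/
def angles (S : Subgroup GG) : AddSubgroup (ℝ × ℝ) where
  carrier := {x | (rot (Circle.exp x.1), rot (Circle.exp x.2)) ∈ S}
  add_mem' {x y} hx hy := by
    have := S.mul_mem hx hy
    rwa [Prod.mk_mul_mk, ← map_mul rot, ← map_mul rot, ← Circle.exp_add, ← Circle.exp_add] at this
  zero_mem' := by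
    simp only [Set.mem_ofPred_eq, Prod.fst_zero, Prod.snd_zero, Circle.exp_zero, map_one]
    exact S.one_mem
  neg_mem' {x} hx := by
    have := S.inv_mem hx
    rwa [Prod.inv_mk, ← map_inv rot, ← map_inv rot, ← Circle.exp_neg, ← Circle.exp_neg] at this

lemma mem_angles {S : Subgroup GG} {x : ℝ × ℝ} :
    x ∈ angles S ↔ (rot (Circle.exp x.1), rot (Circle.exp x.2)) ∈ S := Iff.rfl

lemma isClosed_angles {S : Subgroup GG} (hS : IsClosed (S : Set GG)) :
    IsClosed (angles S : Set (ℝ × ℝ)) :=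
  hS.preimage ((continuous_rot.comp (Circle.exp.continuous.comp continuous_fst)).prodMk
    (continuous_rot.comp (Circle.exp.continuous.comp continuous_snd)))

lemma two_pi_int_mem_angles (S : Subgroup GG) (a b : ℤ) :
    (a * (2 * Real.pi), b * (2 * Real.pi)) ∈ angles S := by
  rw [mem_angles, Circle.exp_int_mul_two_pi, Circle.exp_int_mul_two_pi, map_one]
  exact S.one_mem

lemma exists_angles_of_mem {S : Subgroup GG} (hS : (S : Set GG) ⊆ SO2xSO2) {z : GG} (hz : z ∈ S) :
    ∃ x : ℝ × ℝ, x ∈ Set.Icc (-Real.pi) Real.pi ×ˢ Set.Icc (-Real.pi) Real.pi ∧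
      z = (rot (Circle.exp x.1), rot (Circle.exp x.2)) := by
  obtain ⟨u, hu⟩ := exists_rot_eq_of_mem_specialOrthogonalGroup (hS hz).1
  obtain ⟨v, hv⟩ := exists_rot_eq_of_mem_specialOrthogonalGroup (hS hz).2
  obtain ⟨s, hs, rfl⟩ := Circle.surjOn_exp_neg_pi_pi (Set.mem_univ u)
  obtain ⟨t, ht, rfl⟩ := Circle.surjOn_exp_neg_pi_pi (Set.mem_univ v)
  exact ⟨(s, t), ⟨Set.Ioc_subset_Icc_self hs, Set.Ioc_subset_Icc_self ht⟩, Prod.ext hu hv⟩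

/-- Every element of `S` has angles in a compact square, so infinitely many of them accumulate. The
difference of two close ones is small. -/
lemma exists_small_mem_angles {S : Subgroup GG} (hS : (S : Set GG) ⊆ SO2xSO2)
    (hinf : (S : Set GG).Infinite) {ε : ℝ} (hε : 0 < ε) :
    ∃ x ∈ angles S, x ≠ 0 ∧ ‖x‖ < ε := by
  set K : Set (ℝ × ℝ) := Set.Icc (-Real.pi) Real.pi ×ˢ Set.Icc (-Real.pi) Real.pi
  have hK : IsCompact K := isCompact_Icc.prod isCompact_Icc
  have hinf' : (K ∩ angles S).Infinite := by
    refine Set.Infinite.of_image (fun x => (rot (Circle.exp x.1), rot (Circle.exp x.2))) ?_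
    refine hinf.mono fun z hz => ?_
    obtain ⟨x, hx, rfl⟩ := exists_angles_of_mem hS hz
    exact ⟨x, ⟨hx, hz⟩, rfl⟩
  obtain ⟨a, -, ha⟩ := hinf'.exists_accPt_of_subset_isCompact hK Set.inter_subset_left
  rw [accPt_iff_nhds] at ha
  obtain ⟨x, ⟨hxa, -, hx⟩, hne⟩ := ha (Metric.ball a (ε / 2)) (Metric.ball_mem_nhds a (by linarith))
  have hxpos : 0 < dist x a := dist_pos.2 hne
  -- The radius is at most the distance from `x` to `a`, which guarantees `y ≠ x`.
  obtain ⟨y, ⟨hya, -, hy⟩, -⟩ := ha (Metric.ball a (min (ε / 2) (dist x a)))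
    (Metric.ball_mem_nhds a (lt_min (by linarith) hxpos))
  rw [Metric.mem_ball] at hxa hya
  refine ⟨x - y, (angles S).sub_mem hx hy, ?_, ?_⟩
  · intro h
    rw [sub_eq_zero.1 h] at hya
    exact (lt_min_iff.1 hya).2.ne rfl
  · rw [← dist_eq_norm]
    have := dist_triangle_right x y a
    linarith [(lt_min_iff.1 hya).1]

/-- An infinite closed subgroup of the torus that is killed by a character of bidegree
`(-dp, dq)` contains the one-parameter group of direction `(q, p)`. -/
lemma line_mem_angles {S : Subgroup GG} (hS : (S : Set GG) ⊆ SO2xSO2)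
    (hinf : (S : Set GG).Infinite) (hcl : IsClosed (S : Set GG)) {d : ℕ} {q p : ℤ} (hd : d ≠ 0)
    (hq : q ≠ 0)
    (h : ∀ x ∈ angles S, ∃ k : ℤ, (d : ℝ) * (q * x.2 - p * x.1) = k * (2 * Real.pi)) (t : ℝ) :
    ((q : ℝ) * t, (p : ℝ) * t) ∈ angles S := by
  have hqR : (q : ℝ) ≠ 0 := by exact_mod_cast hq
  have hdR : (d : ℝ) ≠ 0 := by exact_mod_cast hd
  let A : AddSubgroup ℝ :=
    (angles S).comap ((AddMonoidHom.mulLeft (q : ℝ)).prod (AddMonoidHom.mulLeft (p : ℝ)))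
  have hA : ∀ t, t ∈ A ↔ ((q : ℝ) * t, (p : ℝ) * t) ∈ angles S := fun t => Iff.rfl
  have hAcl : IsClosed (A : Set ℝ) :=
    (isClosed_angles hcl).preimage (f := fun t : ℝ => ((q : ℝ) * t, (p : ℝ) * t)) (by fun_prop)
  -- The parameters `t` form a closed subgroup of the real line. With arbitrarily small nonzero
  -- elements it is dense, hence everything.
  have hdense : Dense (A : Set ℝ) := by
    refine AddSubgroup.dense_of_not_isolated_zero A fun ε hε => ?_
    set C : ℝ := d * (|(q : ℝ)| + |(p : ℝ)|) with hC
    have hCpos : 0 < C :=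
      mul_pos (by positivity) (add_pos_of_pos_of_nonneg (abs_pos.2 hqR) (abs_nonneg _))
    -- The phase of the character at `x` is at most `C‖x‖`. Below `2π/C` it must therefore vanish,
    -- which puts `x` on the line itself.
    obtain ⟨x, hx, hx0, hxε⟩ := exists_small_mem_angles hS hinf
      (lt_min hε (div_pos Real.two_pi_pos hCpos))
    rw [lt_min_iff, lt_div_iff₀ hCpos] at hxε
    obtain ⟨k, hk⟩ := h x hx
    have h1 : |x.1| ≤ ‖x‖ := norm_fst_le x
    have h2 : |x.2| ≤ ‖x‖ := norm_snd_le x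
    have hk0 : k = 0 := by
      have hb : |(k : ℝ)| * (2 * Real.pi) < 1 * (2 * Real.pi) := by
        calc |(k : ℝ)| * (2 * Real.pi) = |(d : ℝ) * (q * x.2 - p * x.1)| := by
              rw [hk, abs_mul, abs_of_pos Real.two_pi_pos]
          _ ≤ d * (|(q : ℝ)| * ‖x‖ + |(p : ℝ)| * ‖x‖) := by
              rw [abs_mul, Nat.abs_cast]
              gcongr
              refine (abs_sub _ _).trans ?_
              rw [abs_mul, abs_mul]
              gcongr
          _ = ‖x‖ * C := by rw [hC]; ring
          _ < _ := by linarith [hxε.2]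
      have hb' := lt_of_mul_lt_mul_right hb Real.two_pi_pos.le
      have : |k| < 1 := by exact_mod_cast hb'
      exact Int.abs_lt_one_iff.1 this
    rw [hk0, Int.cast_zero, zero_mul, mul_eq_zero, or_iff_right hdR] at hk
    have hx2 : x = ((q : ℝ) * (x.1 / q), (p : ℝ) * (x.1 / q)) := by
      refine Prod.ext ?_ ?_
      · simp only; field_simp
      · simp only; field_simp; linarith
    have hmem : x.1 / q ∈ A := by rwa [hA, ← hx2]
    have hne : x.1 / q ≠ 0 := by
      intro h0
      rw [h0, mul_zero, mul_zero] at hx2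
      exact hx0 hx2
    have hlt : |x.1 / q| < ε := by
      have hq1 : (1 : ℝ) ≤ |(q : ℝ)| := by exact_mod_cast Int.one_le_abs hq
      rw [abs_div]
      exact (div_le_self (abs_nonneg _) hq1).trans_lt (h1.trans_lt hxε.1)
    refine ⟨|x.1 / q|, ?_, abs_pos.2 hne, hlt⟩
    rcases abs_choice (x.1 / q) with h3 | h3 <;> rw [h3]
    · exact hmem
    · exact A.neg_mem hmem
  have : t ∈ (A : Set ℝ) := by
    rw [← hAcl.closure_eq]
    exact hdense t
  exact this

/-- An infinite closed subgroup of the torus that is killed by a character of bidegree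
`(-dp, dq)` is the kernel of the character of bidegree `(-Mp, Mq)` for a divisor `M` of `d`. -/
lemma exists_divisor_mem_angles_iff {S : Subgroup GG} (hS : (S : Set GG) ⊆ SO2xSO2)
    (hinf : (S : Set GG).Infinite) (hcl : IsClosed (S : Set GG)) {d : ℕ} {q p : ℤ} (hd : d ≠ 0)
    (hq : q ≠ 0) (hqp : IsCoprime q p)
    (h : ∀ x ∈ angles S, ∃ k : ℤ, (d : ℝ) * (q * x.2 - p * x.1) = k * (2 * Real.pi)) :
    ∃ M : ℕ, M ∣ d ∧ ∀ x : ℝ × ℝ, x ∈ angles S ↔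
      ∃ k : ℤ, (M : ℝ) * (q * x.2 - p * x.1) = k * (2 * Real.pi) := by
  -- The phases of the character on `S`, in units of `2π`, form a subgroup of the integers. Dividing
  -- by its generator `e` leaves the character with multiplier `M = |d / e|`.
  let J : AddSubgroup ℤ :=
    { carrier := {k | ∃ x ∈ angles S, (d : ℝ) * (q * x.2 - p * x.1) = k * (2 * Real.pi)}
      add_mem' := by
        rintro k l ⟨x, hx, hxk⟩ ⟨y, hy, hyl⟩
        refine ⟨x + y, (angles S).add_mem hx hy, ?_⟩
        rw [Prod.fst_add, Prod.snd_add, Int.cast_add]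
        linear_combination hxk + hyl
      zero_mem' := ⟨0, (angles S).zero_mem, by simp⟩
      neg_mem' := by
        rintro k ⟨x, hx, hxk⟩
        refine ⟨-x, (angles S).neg_mem hx, ?_⟩
        rw [Prod.fst_neg, Prod.snd_neg, Int.cast_neg]
        linear_combination -hxk }
  have hJ : ∀ k, k ∈ J ↔
      ∃ x ∈ angles S, (d : ℝ) * (q * x.2 - p * x.1) = k * (2 * Real.pi) := fun k => Iff.rfl
  obtain ⟨e, he⟩ := Int.subgroup_cyclic J
  have heJ : ∀ k, k ∈ J ↔ e ∣ k := fun k => by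
    rw [he, ← AddSubgroup.zmultiples_eq_closure, Int.mem_zmultiples_iff]
  have hdJ : (d : ℤ) ∈ J := by
    obtain ⟨b, a, hab⟩ := hqp
    -- The Bézout coefficients give a point of the period lattice whose phase is exactly `2πd`.
    -- Hence `e` divides `d`.
    refine ⟨_, two_pi_int_mem_angles S (-a) b, ?_⟩
    have habR : (b : ℝ) * q + a * p = 1 := by exact_mod_cast hab
    push_cast
    linear_combination (d : ℝ) * (2 * Real.pi) * habR
  obtain ⟨c, hc⟩ := (heJ d).1 hdJ
  have he0 : e ≠ 0 := by
    rintro rfl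
    rw [zero_mul] at hc
    exact hd (by exact_mod_cast hc)
  have hd' : d = e.natAbs * c.natAbs := by
    rw [← Int.natAbs_mul, ← hc, Int.natAbs_natCast]
  have heR : ((e.natAbs : ℕ) : ℝ) ≠ 0 := by exact_mod_cast Int.natAbs_ne_zero.2 he0
  have hdR : (d : ℝ) = (e.natAbs : ℕ) * (c.natAbs : ℕ) := by exact_mod_cast hd'
  refine ⟨c.natAbs, ⟨e.natAbs, by rw [hd', mul_comm]⟩, fun x => ⟨fun hx => ?_, ?_⟩⟩
  · obtain ⟨k, hk⟩ := h x hx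
    obtain ⟨j, hj⟩ := Int.natAbs_dvd.2 ((heJ k).1 ⟨x, hx, hk⟩)
    refine ⟨j, mul_left_cancel₀ heR ?_⟩
    have hjR : (k : ℝ) = (e.natAbs : ℕ) * j := by
      simpa only [Int.cast_mul, Int.cast_natCast] using congrArg (Int.cast : ℤ → ℝ) hj
    rw [hjR, hdR] at hk
    linear_combination hk
  · rintro ⟨j, hj⟩
    -- A point `y` of `S` with the same phase as `x` is chosen. The difference then lies on the line
    -- of direction `(q, p)`, which is already contained in `S`.
    obtain ⟨y, hy, hyk⟩ := (heJ ((e.natAbs : ℕ) * j)).2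
      (Dvd.dvd.mul_right (Int.dvd_natAbs.2 dvd_rfl) _)
    have hqR : (q : ℝ) ≠ 0 := by exact_mod_cast hq
    have hdR0 : (d : ℝ) ≠ 0 := by exact_mod_cast hd
    have hdiff : (q : ℝ) * (x.2 - y.2) = p * (x.1 - y.1) := by
      refine mul_left_cancel₀ hdR0 ?_
      rw [Int.cast_mul, Int.cast_natCast] at hyk
      have : (d : ℝ) * (q * x.2 - p * x.1) = (e.natAbs : ℕ) * (j * (2 * Real.pi)) := by
        rw [← hj, hdR]; ring
      linear_combination this - hyk
    have hl := line_mem_angles hS hinf hcl hd hq h ((x.1 - y.1) / q)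
    have hxy : x = ((q : ℝ) * ((x.1 - y.1) / q), (p : ℝ) * ((x.1 - y.1) / q)) + y := by
      refine Prod.ext ?_ ?_
      · simp only [Prod.fst_add]; field_simp; ring
      · simp only [Prod.snd_add]; field_simp; linarith
    rw [hxy]
    exact (angles S).add_mem hl hy

/-- Every multiplier `M` is attained: `N = M|q|` is a suitable choice. -/
lemma cycOrder_mul_natAbs (M : ℕ) {q : ℤ} (hq : q ≠ 0) : cycOrder (M * q.natAbs) q = M := by
  rw [cycOrder, Nat.gcd_eq_right (dvd_mul_left _ _),
    Nat.mul_div_cancel _ (Int.natAbs_pos.2 hq)]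

/-- With `d = gcd(m, n)`, take `q = n/d` and `p = -m/d`. All of `d`, `q`, `p` are odd as divisors of
odd numbers up to sign, and so is the multiplier `M ∣ d`; then `N = M|q|`. -/
theorem exists_eq_H {S : Subgroup GG} (hS : (S : Set GG) ⊆ SO2xSO2)
    (hinf : (S : Set GG).Infinite) (hcl : IsClosed (S : Set GG)) {m n : ℤ} (hm : Odd m)
    (hn : Odd n) (h : ∀ u v : Circle, (rot u, rot v) ∈ S → u ^ m * v ^ n = 1) :
    ∃ (N : ℕ) (q p : ℤ), Odd N ∧ Odd q ∧ Odd p ∧ IsCoprime q p ∧ S = H N q p := by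
  have hn0 : n ≠ 0 := by rintro rfl; simp at hn
  have hd0 : m.gcd n ≠ 0 := fun h => hn0 (Int.gcd_eq_zero_iff.1 h).2
  obtain ⟨d, m', n', -, hcop, hm', hn'⟩ := Int.exists_gcd_one' (Nat.pos_of_ne_zero hd0)
  have hd : Odd (d : ℤ) := Int.Odd.of_mul_right (hm' ▸ hm)
  have hp : Odd (-m') := (Int.Odd.of_mul_left (hm' ▸ hm)).neg
  have hq : Odd n' := Int.Odd.of_mul_left (hn' ▸ hn)
  have hq0 : n' ≠ 0 := by rintro rfl; simp at hq
  have hqp : IsCoprime n' (-m') := (Int.isCoprime_iff_gcd_eq_one.2 hcop).symm.neg_right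
  have hdne : d ≠ 0 := by rintro rfl; simp at hd
  obtain ⟨M, hMd, hM⟩ := exists_divisor_mem_angles_iff hS hinf hcl (d := d) hdne hq0 hqp
    fun x hx => by
      have hx' := h _ _ hx
      rw [← Circle.exp_intCast_mul, ← Circle.exp_intCast_mul, ← Circle.exp_add,
        Circle.exp_eq_one] at hx'
      obtain ⟨k, hk⟩ := hx'
      refine ⟨k, ?_⟩
      rw [← hk, hm', hn']
      push_cast
      ring
  have hModd : Odd M := Odd.of_dvd_nat (by exact_mod_cast hd) hMd
  have hN : Odd (M * n'.natAbs) := hModd.mul (Int.natAbs_odd.2 hq)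
  refine ⟨M * n'.natAbs, n', -m', hN, hq, hp, hqp, SetLike.ext' ?_⟩
  rw [coe_H_eq hN.pos.ne' hq0 hqp, cycOrder_mul_natAbs M hq0]
  have key : ∀ x : ℝ × ℝ, x ∈ angles S ↔ Circle.exp x.1 ^ (-(-m' * (M : ℤ))) *
      Circle.exp x.2 ^ (n' * (M : ℤ)) = 1 := by
    intro x
    rw [hM, ← Circle.exp_intCast_mul, ← Circle.exp_intCast_mul, ← Circle.exp_add,
        Circle.exp_eq_one]
    refine exists_congr fun k => ?_
    push_cast
    constructor <;> intro hk <;> linear_combination hk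
  ext z
  constructor
  · intro hz
    obtain ⟨x, -, rfl⟩ := exists_angles_of_mem hS hz
    exact ⟨_, _, rfl, (key x).1 hz⟩
  · rintro ⟨u, v, rfl, huv⟩
    obtain ⟨s, rfl⟩ := Circle.exp_surjective u
    obtain ⟨t, rfl⟩ := Circle.exp_surjective v
    exact (key (s, t)).2 huv

/-! ### Potential and actual little groups -/

/-- `H(N, q, p)` is the kernel of a character both of whose degrees are odd, so the sign function of
that character has it as exact stabilizer. -/
lemma exists_littleGroup_eq_H {N : ℕ} {q p : ℤ} (hN : Odd N) (hq : Odd q) (hp : Odd p)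
    (hqp : IsCoprime q p) : ∃ φ : L2Dual, φ ≠ 0 ∧ littleGroup φ = (H N q p : Set GG) := by
  have hM : Odd (cycOrder N q : ℤ) := by
    have : Odd (cycOrder N q) := Odd.of_dvd_nat hN ⟨_, (cycOrder_mul N q).symm⟩
    exact_mod_cast this
  have hq0 : q ≠ 0 := by rintro rfl; simp at hq
  refine ⟨func (signFun (-(p * cycOrder N q)) (q * cycOrder N q)), func_signFun_ne_zero _ _, ?_⟩
  rw [littleGroup_signFun (hp.mul hM).neg (hq.mul hM), coe_H_eq hN.pos.ne' hq0 hqp]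

theorem isInfinitePotentialLittleGroup_H {N : ℕ} {q p : ℤ} (hN : Odd N) (hq : Odd q) (hp : Odd p)
    (hqp : IsCoprime q p) : IsInfinitePotentialLittleGroup (H N q p) where
  le_SO2xSO2 z hz := by
    obtain ⟨x, y, rfl⟩ := H_subset_range_rot hz
    exact ⟨rot_mem_specialOrthogonalGroup x, rot_mem_specialOrthogonalGroup y⟩
  isClosed := isClosed_H hN.pos.ne' (by rintro rfl; simp at hq) hqp
  infinite := infinite_H hN.pos.ne' (by rintro rfl; simp at hq) hqp
  invariants_ne_bot := by
    obtain ⟨φ, hφ0, hφ⟩ := exists_littleGroup_eq_H hN hq hp hqp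
    exact (Submodule.ne_bot_iff _).2 ⟨φ, fun z hz => hφ.ge hz, hφ0⟩

theorem exists_eq_H_of_isInfinitePotentialLittleGroup {S : Subgroup GG}
    (hS : IsInfinitePotentialLittleGroup S) :
    ∃ (N : ℕ) (q p : ℤ), Odd N ∧ Odd q ∧ Odd p ∧ IsCoprime q p ∧ S = H N q p := by
  obtain ⟨m, n, hm, hn, h⟩ := exists_odd_characters hS.invariants_ne_bot
  exact exists_eq_H hS.le_SO2xSO2 hS.infinite hS.isClosed hm hn h

end HB

end

theorem mainTheorem1 :
    (∀ S : Subgroup HB.GG, HB.IsInfinitePotentialLittleGroup S → HB.IsLittleGroup S) ∧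
    (∀ S : Subgroup HB.GG, HB.IsInfinitePotentialLittleGroup S ↔
      ∃ (N : ℕ) (q p : ℤ), Odd N ∧ Odd q ∧ Odd p ∧ IsCoprime q p ∧ S = HB.H N q p) ∧
    (∀ (N : ℕ) (q p : ℤ), Odd N → Odd q → Odd p → IsCoprime q p →
      Nonempty (HB.H N q p ≃ₜ* Multiplicative (ZMod (N / N.gcd q.natAbs)) × Circle)) := by
  refine ⟨fun S hS => ?_, fun S => ⟨HB.exists_eq_H_of_isInfinitePotentialLittleGroup, ?_⟩, ?_⟩
  · obtain ⟨N, q, p, hN, hq, hp, hqp, rfl⟩ := HB.exists_eq_H_of_isInfinitePotentialLittleGroup hS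
    obtain ⟨φ, -, hφ⟩ := HB.exists_littleGroup_eq_H hN hq hp hqp
    exact ⟨φ, hφ⟩
  · rintro ⟨N, q, p, hN, hq, hp, hqp, rfl⟩
    exact HB.isInfinitePotentialLittleGroup_H hN hq hp hqp
  · intro N q p hN hq hp hqp
    exact HB.nonempty_H_equiv hN.pos.ne' (by rintro rfl; simp at hq) hqp
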